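/- Let $(X,d)$ be a metric space with a Borel measure $\mu$ that is $n$-Ahlfors--David regular for some $n>0$: there are $c_l,c_u>0$ with $c_l r^{n}\le \mu(B(x,r))\le c_u r^{n}$ for all $x\in X$ and $0<r<\operatorname{diam}X$. Let $\Omega\subset X$ be a bounded John domain, i.e. $\Omega$ is bounded, open and connected, and there are $x_0\in\Omega$ and $c_J>0$ such that every $x\in\Omega$ is joined to $x_0$ by a rectifiable curve $c:[0,l]\to\Omega$ parametrized by arc length with $c(0)=x$, $c(l)=x_0$ and $d(c(t),\partial\Omega)\ge t/c_J$ for $t\in[0,l]$. Write $d(x)=d(x,\partial\Omega)$, and assume that for some $\kappa>0$ one has $B(x,\kappa\, d(x))\subset\Omega$ for all $x\in\Omega$ (this is automatic, with $\kappa=1$, when $X$ is a length space). Let $F\subset\partial\Omega$ be a nonempty compact set and $d_F(x)=d(x,F)$. Let $\phi:(0,\infty)\to(0,\infty)$ be nondecreasing with $\phi(2t)\le K\phi(t)$ for all $t>0$ and some constant $K$, and suppose that $w_\phi^F:=\phi(d_F(\cdot))\in L^1_{\mathrm{loc}}(\Omega,\mu)$. Let $s,\tau\in(0,1)$ and $0\le\gamma<s\le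 n$ with $s-\gamma<n$, and put $$1^*_{s-\gamma}=\frac{n}{n-(s-\gamma)},\qquad \Phi(t)=\phi(t)^{1/1^*_{s-\gamma}},\qquad v(z,y)=\min_{\xi\in\{z,y\}} d(\xi)^{\gamma}\,\Phi(d_F(\xi)).$$ Then there is a constant $C>0$ such that for every $u\in L^1(\Omega,\mu)$ (in particular for every $u$ in the fractional Sobolev space $W^{s,1}(\Omega,\mu)$) $$\inf_{a\in\mathbb R}\left(\int_\Omega |u-a|^{1^*_{s-\gamma}}\,w_\phi^F\,d\mu\right)^{1/1^*_{s-\gamma}}\le C\int_\Omega\int_{\Omega\cap\{z:\,d(z,y)\le\tau d(y)\}}\frac{|u(z)-u(y)|\,v(z,y)}{\mu\big(B(z,d(z,y))\big)\,d(z,y)^{s}}\,d\mu(z)\,d\mu(y),$$ where both sides may be infinite. -/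

import Mathlib

open MeasureTheory Set

noncomputable section

namespace FracPoincare

/-- Ahlfors--David regularity with exponent `η`:
`c_l r ^ η ≤ μ (B(x, r)) ≤ c_u r ^ η` for all `x` and `0 < r < diam X`
(the diameter is taken in `[0, ∞]`, so that unbounded spaces are covered). -/
def IsAhlforsDavidRegular {X : Type*} [MetricSpace X] [MeasurableSpace X]
    (μ : Measure X) (η : ℝ) : Prop :=
  ∃ cl cu : ℝ, 0 < cl ∧ 0 < cu ∧ ∀ (x : X) (r : ℝ), 0 < r →
    ENNReal.ofReal r < Metric.ediam (univ : Set X) →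
      ENNReal.ofReal (cl * r ^ η) ≤ μ (Metric.ball x r) ∧
        μ (Metric.ball x r) ≤ ENNReal.ofReal (cu * r ^ η)

/-- `d(x) = d(x, ∂Ω)`. -/
def bdryDist {X : Type*} [MetricSpace X] (Ω : Set X) (x : X) : ℝ :=
  Metric.infDist x (frontier Ω)

/-- John domains: open connected sets `Ω` with a central point `x₀` such that every `x ∈ Ω` is
joined to `x₀` in `Ω` by a rectifiable curve `c : [0, l] → Ω`, parametrized by arc length, with
`d(c(t), ∂Ω) ≥ t / c_J`. -/
structure IsJohnDomain {X : Type*} [MetricSpace X] (Ω : Set X) : Prop where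
  isOpen : IsOpen Ω
  isConnected : IsConnected Ω
  exists_curve : ∃ x₀ ∈ Ω, ∃ cJ : ℝ, 0 < cJ ∧ ∀ x ∈ Ω, ∃ (l : ℝ) (c : ℝ → X),
    0 ≤ l ∧ HasUnitSpeedOn c (Icc 0 l) ∧ MapsTo c (Icc 0 l) Ω ∧ c 0 = x ∧ c l = x₀ ∧
      ∀ t ∈ Icc 0 l, t / cJ ≤ bdryDist Ω (c t)

/-- The weight `w_φ^F(x) = φ(d(x, F))`. -/
def distWeight {X : Type*} [MetricSpace X] (F : Set X) (φ : ℝ → ℝ) (x : X) : ℝ :=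
  φ (Metric.infDist x F)

/-- The weight `v_{Φ,α}^F(x, y) = min_{z ∈ {x, y}} d(z) ^ α Φ(d(z, F))`. -/
def pairWeight {X : Type*} [MetricSpace X] (Ω F : Set X) (Φ : ℝ → ℝ) (α : ℝ) (x y : X) : ℝ :=
  min (bdryDist Ω x ^ α * Φ (Metric.infDist x F)) (bdryDist Ω y ^ α * Φ (Metric.infDist y F))

/-- The seminorm `[u]_{W_τ^{s,p}(Ω, w)}`, with values in `[0, ∞]`. -/
def fracSeminorm {X : Type*} [MetricSpace X] [MeasurableSpace X] (μ : Measure X) (Ω : Set X)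
    (s p τ : ℝ) (w : X → X → ℝ) (u : X → ℝ) : ENNReal :=
  (∫⁻ y in Ω, ∫⁻ z in Ω ∩ {z | dist z y ≤ τ * bdryDist Ω y},
    ENNReal.ofReal (|u z - u y| ^ p * w z y) /
      (μ (Metric.ball z (dist z y)) * ENNReal.ofReal (dist z y ^ (s * p))) ∂μ ∂μ) ^ (1 / p)

/-- The norm of `L^q(Ω, w dμ)`, with values in `[0, ∞]`. -/
def weightedNorm {X : Type*} [MetricSpace X] [MeasurableSpace X] (μ : Measure X) (Ω : Set X)
    (q : ℝ) (w : X → ℝ) (f : X → ℝ) : ENNReal :=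
  eLpNorm f (ENNReal.ofReal q) ((μ.restrict Ω).withDensity fun x => ENNReal.ofReal (w x))

/-- The Sobolev exponent `p*_σ = n p / (n - σ p)`. -/
def sobolevExponent (n σ p : ℝ) : ℝ := n * p / (n - σ * p)

end FracPoincare

end

open MeasureTheory Set

noncomputable section

namespace FracPoincare

open Metric Filter Topology

/-! The inequality is derived from a weighted isoperimetric inequality for a nonlocal perimeter, in
the manner of Maz'ya. Let `q = n / (n - (s - γ))` and let `E ⊆ Ω` fill at most half of a fixed ball
around the John centre. Almost every `x ∈ E` has a "balanced" ball `B(p, r)` with `r ≲ d(p)` and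
`dist x p ≲ r`, in which both `E` and its complement occupy a fixed proportion: by Lebesgue density
`E` prevails near `x`, it does not prevail near `x₀`, and the balance tips either while the radius
at `x` grows to `ε d(x)` or at a point of the John curve (`ae_exists_balanced`).

On a balanced ball the weights are essentially constant, and integrating the kernel over pairs
separated by `E` controls the `1/q`-th power of the weighted measure of any fixed enlargement
(`exists_measure_ball_le_of_balanced`). A Vitali selection sums these bounds, since `q ≥ 1`
(`measure_le_rpow_of_local`), which gives `exists_measure_le_kernelPerimeter`.

Applied to the superlevel sets of `(u - a)⁺` and `(u - a)⁻`, with `a` a median on the central ball,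
the isoperimetric inequality yields the theorem through the layer-cake and coarea formulas
(`exists_eLpNorm_sub_const_le_of_isoperimetric`). The argument runs on the subtype `Ω`. -/

/-! ### Total boundedness and finite measure of John domains. -/

theorem totallyBounded_ball_of_regular {X : Type*} [MetricSpace X] [MeasurableSpace X]
    [BorelSpace X] {μ : Measure X} {η cl cu : ℝ} (hcl : 0 < cl)
    (hμ : ∀ (x : X) (r : ℝ), 0 < r → ENNReal.ofReal r < Metric.ediam (univ : Set X) →
      ENNReal.ofReal (cl * r ^ η) ≤ μ (ball x r) ∧ μ (ball x r) ≤ ENNReal.ofReal (cu * r ^ η))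
    (x : X) {R : ℝ} (hR : 0 < R) (hRD : ENNReal.ofReal (2 * R) < Metric.ediam (univ : Set X)) :
    TotallyBounded (ball x R) := by
  rw [Metric.totallyBounded_iff]
  intro ε hε
  set ρ := min ε R / 5 with hρ
  have hm : 0 < min ε R := lt_min hε hR
  have hρ0 : 0 < ρ := by positivity
  have h1 : min ε R ≤ ε := min_le_left _ _
  have h2 : min ε R ≤ R := min_le_right _ _
  obtain ⟨u, hut, hdisj, hcov⟩ := Vitali.exists_disjoint_subfamily_covering_enlargement
    (fun a : X => ball a ρ) (ball x R) (fun _ => ρ) 2 (by norm_num) (fun _ _ => hρ0.le) ρ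
    (fun _ _ => le_rfl) (fun a _ => ⟨a, mem_ball_self hρ0⟩)
  have hρD : ENNReal.ofReal ρ < Metric.ediam (univ : Set X) :=
    lt_of_le_of_lt (ENNReal.ofReal_le_ofReal (by linarith)) hRD
  have hsub : (⋃ a : u, ball (a : X) ρ) ⊆ ball x (2 * R) := by
    refine iUnion_subset fun a => ball_subset_ball' ?_
    have := mem_ball.1 (hut a.2)
    linarith
  -- Disjoint balls whose measures are bounded below, all inside one ball of finite measure, are
  -- finitely many.
  have hfin := Measure.finite_const_le_meas_of_disjoint_iUnion μ
    (ε := ENNReal.ofReal (cl * ρ ^ η)) (by rw [ENNReal.ofReal_pos]; positivity)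
    (As := fun a : u => ball (a : X) ρ) (fun a => measurableSet_ball)
    (fun a b hab => hdisj a.2 b.2 (fun h => hab (Subtype.ext h)))
    (ne_top_of_le_ne_top ENNReal.ofReal_ne_top
      ((measure_mono hsub).trans (hμ x (2 * R) (by linarith) hRD).2))
  have hall : {i : u | ENNReal.ofReal (cl * ρ ^ η) ≤ μ (ball (i : X) ρ)} = univ :=
    eq_univ_of_forall fun a => (hμ a ρ hρ0 hρD).1
  rw [hall, finite_univ_iff] at hfin
  refine ⟨u, Set.toFinite u, fun a ha => ?_⟩
  obtain ⟨b, hb, ⟨z, hza, hzb⟩, -⟩ := hcov a ha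
  refine mem_iUnion₂.2 ⟨b, hb, ?_⟩
  rw [mem_ball] at *
  have := dist_triangle a z b
  rw [dist_comm] at hza
  linarith

/-- Points joined to `x₀` by a `1`-Lipschitz curve of length at most `L` form a totally bounded
set of finite measure. -/
theorem totallyBounded_and_measure_lt_top_of_curves {X : Type*} [MetricSpace X]
    [MeasurableSpace X] [BorelSpace X] {μ : Measure X} {r₀ : ℝ} (hr₀ : 0 < r₀)
    (htb : ∀ x : X, TotallyBounded (ball x (3 * r₀))) (hfin : ∀ x : X, μ (ball x r₀) < ⊤)
    (x₀ : X) (k : ℕ) :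
    TotallyBounded {x : X | ∃ (l : ℝ) (c : ℝ → X), 0 ≤ l ∧ l ≤ k * r₀ ∧
      LipschitzOnWith 1 c (Icc 0 l) ∧ c 0 = x ∧ c l = x₀} ∧
    μ {x : X | ∃ (l : ℝ) (c : ℝ → X), 0 ≤ l ∧ l ≤ k * r₀ ∧
      LipschitzOnWith 1 c (Icc 0 l) ∧ c 0 = x ∧ c l = x₀} < ⊤ := by
  have key : ∀ S : Set X, TotallyBounded S → μ S < ⊤ := by
    intro S hS
    obtain ⟨t, ht, hSt⟩ := Metric.totallyBounded_iff.1 hS r₀ hr₀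
    exact (measure_mono hSt).trans_lt
      (measure_biUnion_lt_top ht fun a _ => hfin a)
  refine ⟨?_, key _ ?_⟩ <;>
  · induction k with
    | zero =>
      refine (htb x₀).subset ?_
      rintro x ⟨l, c, hl, hlk, hc, rfl, hx⟩
      have : l = 0 := le_antisymm (by simpa using hlk) hl
      subst this
      rw [hx]
      exact mem_ball_self (by linarith)
    | succ k ih =>
      obtain ⟨t, ht, hSt⟩ := Metric.totallyBounded_iff.1 ih r₀ hr₀
      refine (((totallyBounded_biUnion ht).2 fun a _ => htb a).union (htb x₀)).subset ?_
      rintro x ⟨l, c, hl, hlk, hc, rfl, hx⟩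
      rcases le_total l r₀ with h | h
      · right
        have := hc.dist_le_mul 0 ⟨le_rfl, hl⟩ l ⟨hl, le_rfl⟩
        rw [hx] at this
        simp only [NNReal.coe_one, one_mul, dist_zero_left, Real.norm_eq_abs, abs_of_nonneg hl]
          at this
        rw [mem_ball]
        linarith
      · left
        -- Dropping the initial stretch of length `r₀` lands in the previous set, at distance at
        -- most `r₀` from `x`.
        have hy : c r₀ ∈ {x : X | ∃ (l : ℝ) (c : ℝ → X), 0 ≤ l ∧ l ≤ k * r₀ ∧
            LipschitzOnWith 1 c (Icc 0 l) ∧ c 0 = x ∧ c l = x₀} := by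
          refine ⟨l - r₀, fun t => c (t + r₀), by linarith, ?_, ?_, by simp, by simpa using hx⟩
          · push_cast at hlk
            linarith
          · refine LipschitzOnWith.of_dist_le_mul fun a ha b hb => ?_
            have := hc.dist_le_mul (a + r₀) ⟨by linarith [ha.1], by linarith [ha.2]⟩
              (b + r₀) ⟨by linarith [hb.1], by linarith [hb.2]⟩
            simpa using this
        obtain ⟨a, ha, hca⟩ := mem_iUnion₂.1 (hSt hy)
        refine mem_iUnion₂.2 ⟨a, ha, ?_⟩
        have := hc.dist_le_mul 0 ⟨le_rfl, hl⟩ r₀ ⟨hr₀.le, h⟩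
        simp only [NNReal.coe_one, one_mul, dist_zero_left, Real.norm_eq_abs, abs_of_pos hr₀]
          at this
        rw [mem_ball] at *
        have := dist_triangle (c 0) (c r₀) a
        linarith

theorem lipschitzOnWith_of_hasUnitSpeedOn {X : Type*} [MetricSpace X] {c : ℝ → X} {l : ℝ}
    (hc : HasUnitSpeedOn c (Icc 0 l)) : LipschitzOnWith 1 c (Icc 0 l) := by
  refine LipschitzOnWith.of_dist_le_mul fun a ha b hb => ?_
  wlog hab : a ≤ b generalizing a b
  · rw [dist_comm, dist_comm a b]
    exact this b hb a ha (le_of_not_ge hab)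
  have h := hc ha hb
  have h2 : edist (c a) (c b) ≤ eVariationOn c (Icc 0 l ∩ Icc a b) :=
    eVariationOn.edist_le c ⟨ha, le_rfl, hab⟩ ⟨hb, hab, le_rfl⟩
  rw [h, NNReal.coe_one, one_mul, edist_dist, ENNReal.ofReal_le_ofReal_iff (by linarith)] at h2
  rw [dist_comm a b, Real.dist_eq, abs_of_nonneg (by linarith : 0 ≤ b - a)]
  simpa using h2

/-- Regularity only speaks of radii below the diameter, so boundedness of `Ω` does not immediately
give finite measure. Instead, the John condition at the endpoint `x₀` bounds the length of every
curve by `cJ * d(x₀)`, and curves of bounded length are cut into short pieces. -/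
theorem IsJohnDomain.totallyBounded_and_measure_lt_top {X : Type*} [MetricSpace X]
    [MeasurableSpace X] [BorelSpace X] {μ : Measure X} {n : ℝ}
    (hμ : IsAhlforsDavidRegular μ n) {Ω : Set X} (hΩ : IsJohnDomain Ω)
    (hD : Metric.ediam (univ : Set X) ≠ 0) : TotallyBounded Ω ∧ μ Ω < ⊤ := by
  obtain ⟨cl, cu, hcl, -, hμ⟩ := hμ
  obtain ⟨x₀, hx₀, cJ, hcJ, hJ⟩ := hΩ.exists_curve
  obtain ⟨R, hR0, hRD⟩ : ∃ R : ℝ, 0 < R ∧ ENNReal.ofReal R < Metric.ediam (univ : Set X) := by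
    obtain ⟨R, h1, h2⟩ := ENNReal.lt_iff_exists_nnreal_btwn.1 (pos_iff_ne_zero.2 hD)
    exact ⟨R, by simpa using h1, by simpa using h2⟩
  -- With `r₀ = R / 6`, the balls of radius `3 * r₀` have double radius exactly `R`, still below the
  -- diameter.
  obtain ⟨k, hk⟩ := exists_nat_ge (cJ * bdryDist Ω x₀ / (R / 6))
  have hr₀ : 0 < R / 6 := by positivity
  have H := totallyBounded_and_measure_lt_top_of_curves (μ := μ) hr₀
    (fun x => totallyBounded_ball_of_regular hcl hμ x (by positivity)
      (by convert hRD using 2; ring))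
    (fun x => (hμ x (R / 6) hr₀ ((ENNReal.ofReal_le_ofReal (by linarith)).trans_lt hRD)).2.trans_lt
      ENNReal.ofReal_lt_top) x₀ k
  have hsub : Ω ⊆ {x : X | ∃ (l : ℝ) (c : ℝ → X), 0 ≤ l ∧ l ≤ k * (R / 6) ∧
      LipschitzOnWith 1 c (Icc 0 l) ∧ c 0 = x ∧ c l = x₀} := by
    intro x hx
    obtain ⟨l, c, hl, hc, -, h0, h1, hd⟩ := hJ x hx
    refine ⟨l, c, hl, ?_, lipschitzOnWith_of_hasUnitSpeedOn hc, h0, h1⟩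
    have := hd l ⟨hl, le_rfl⟩
    rw [h1, div_le_iff₀ hcJ] at this
    rw [div_le_iff₀ hr₀] at hk
    linarith
  exact ⟨H.1.subset hsub, (measure_mono hsub).trans_lt H.2⟩

/-! ### Density of a set and balanced balls. -/

theorem measure_le_two_mul_diff {Y : Type*} [MeasurableSpace Y] {ν : Measure Y} {E B : Set Y}
    (hE : MeasurableSet E) (hB : ν B ≠ ⊤) (h : ¬ ν B < 2 * ν (E ∩ B)) :
    ν B ≤ 2 * ν (B \ E) := by
  rw [not_lt] at h
  have h1 := measure_inter_add_sdiff B hE (μ := ν)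
  rw [inter_comm] at h1
  have h2 : ν (E ∩ B) ≠ ⊤ := ne_top_of_le_ne_top hB (measure_mono inter_subset_right)
  have h3 : ν (B \ E) ≠ ⊤ := ne_top_of_le_ne_top hB (measure_mono sdiff_subset)
  rw [← h1] at h ⊢
  lift ν (E ∩ B) to NNReal using h2 with a
  lift ν (B \ E) to NNReal using h3 with b
  norm_cast at h ⊢
  have h' : (2 * a : ℝ) ≤ a + b := by exact_mod_cast h
  have : (a + b : ℝ) ≤ 2 * b := by linarith
  exact_mod_cast this

theorem ofReal_le_of_two_mul {a : ℝ} {m k : ENNReal} (h : ENNReal.ofReal (2 * a) ≤ m)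
    (h' : m ≤ 2 * k) : ENNReal.ofReal a ≤ k := by
  have h2 := h.trans h'
  rw [ENNReal.ofReal_mul (by norm_num), ENNReal.ofReal_ofNat] at h2
  exact (ENNReal.mul_le_mul_iff_right (by norm_num) (by norm_num)).1 h2

theorem exists_mem_frontier_of_isPreconnected {Y : Type*} [TopologicalSpace Y] {S A : Set Y}
    (hS : IsPreconnected S) (h : (S ∩ A).Nonempty) (h' : (S ∩ Aᶜ).Nonempty) :
    (S ∩ frontier A).Nonempty := by
  by_contra hne
  have hcover : ∀ y ∈ S, y ∉ frontier A := fun y hy hyA => hne ⟨y, hy, hyA⟩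
  have h1 : ∀ y ∈ S, y ∈ A → y ∈ interior A := fun y hy hyA => by
    by_contra hi
    exact hcover y hy ⟨subset_closure hyA, hi⟩
  have h2 : ∀ y ∈ S, y ∈ Aᶜ → y ∈ interior Aᶜ := fun y hy hyA => by
    by_contra hi
    exact hcover y hy (frontier_compl A ▸ ⟨subset_closure hyA, hi⟩)
  obtain ⟨x, hx, hxA⟩ := h
  obtain ⟨x', hx', hxA'⟩ := h'
  obtain ⟨z, -, hz1, hz2⟩ := hS (interior A) (interior Aᶜ) isOpen_interior isOpen_interior
    (fun y hy => (em (y ∈ A)).imp (h1 y hy) (h2 y hy)) ⟨x, hx, h1 x hx hxA⟩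
    ⟨x', hx', h2 x' hx' hxA'⟩
  exact interior_subset hz2 (interior_subset hz1)

section Balanced

variable {Y : Type*} [MetricSpace Y] [MeasurableSpace Y] {ν : Measure Y}
  {d : Y → ℝ} {n cl cu κ ε : ℝ} {E : Set Y}

/-- Both `E` and its complement fill a fixed proportion of a ball centred at a frontier point of
the set where `E` has density more than `1 / 2` at scale `ε d`. -/
theorem balanced_of_mem_frontier (hd : LipschitzWith 1 d) (hdpos : ∀ y, 0 < d y) (hn : 0 < n)
    (hcl : 0 < cl)
    (hlow : ∀ x r, 0 < r → r ≤ κ * d x → ENNReal.ofReal (cl * r ^ n) ≤ ν (closedBall x r))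
    (hfin : ∀ x r, ν (closedBall x r) ≠ ⊤) (hε : 0 < ε) (hε1 : ε ≤ 1) (hεκ : ε ≤ κ)
    (hE : MeasurableSet E) {p : Y}
    (hp : p ∈ frontier {p | ν (closedBall p (ε * d p)) < 2 * ν (E ∩ closedBall p (ε * d p))}) :
    ENNReal.ofReal (cl / 2 * (1 / 4) ^ n * (2 * ε * d p) ^ n) ≤
        ν (E ∩ closedBall p (2 * ε * d p)) ∧
      ENNReal.ofReal (cl / 2 * (1 / 4) ^ n * (2 * ε * d p) ^ n) ≤
        ν (closedBall p (2 * ε * d p) \ E) := by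
  have hdp := hdpos p
  have hη : 0 < ε * d p / 4 := by positivity
  have hlip : ∀ q, dist p q < ε * d p / 4 → |d p - d q| ≤ ε * d p / 4 := by
    intro q hq
    have := hd.dist_le_mul p q
    rw [Real.dist_eq] at this
    simp only [NNReal.coe_one, one_mul] at this
    linarith
  have hεd : ε * d p ≤ d p := by nlinarith
  have hsub : ∀ q, dist p q < ε * d p / 4 →
      closedBall q (ε * d q) ⊆ closedBall p (2 * ε * d p) := by
    intro q hq
    refine closedBall_subset_closedBall' ?_
    have h1 := abs_le.1 (hlip q hq)
    rw [dist_comm] at hq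
    have : ε * d q ≤ ε * d p + ε * (ε * d p / 4) := by nlinarith [h1.1]
    nlinarith
  have hvol : ∀ q, dist p q < ε * d p / 4 →
      ENNReal.ofReal (2 * (cl / 2 * (1 / 4) ^ n * (2 * ε * d p) ^ n)) ≤
        ν (closedBall q (ε * d q)) := by
    intro q hq
    have h1 := abs_le.1 (hlip q hq)
    have hdq := hdpos q
    refine le_trans (ENNReal.ofReal_le_ofReal ?_)
      (hlow q (ε * d q) (by positivity) (by gcongr))
    -- Here `d q ≥ d p / 2`, so `ε * d q` is at least a quarter of the radius `2 * ε * d p`; the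
    -- factor `cl / 2` comes from the density threshold.
    have h2 : (1 / 4 : ℝ) ^ n * (2 * ε * d p) ^ n ≤ (ε * d q) ^ n := by
      rw [← Real.mul_rpow (by norm_num) (by positivity)]
      refine Real.rpow_le_rpow (by positivity) ?_ hn.le
      nlinarith [h1.2]
    calc 2 * (cl / 2 * (1 / 4) ^ n * (2 * ε * d p) ^ n)
        = cl * ((1 / 4 : ℝ) ^ n * (2 * ε * d p) ^ n) := by ring
      _ ≤ _ := by gcongr
  -- A frontier point is a limit both of points where `E` has density above `1 / 2` and of points
  -- where it does not; the balls at either kind of nearby point lie in the doubled ball at `p`.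
  constructor
  · obtain ⟨q, hqA, hq⟩ := Metric.mem_closure_iff.1 (frontier_subset_closure hp) _ hη
    refine (ofReal_le_of_two_mul (hvol q hq) (le_of_lt hqA)).trans (measure_mono ?_)
    exact inter_subset_inter_right _ (hsub q hq)
  · rw [← frontier_compl] at hp
    obtain ⟨q, hqA, hq⟩ := Metric.mem_closure_iff.1 (frontier_subset_closure hp) _ hη
    refine (ofReal_le_of_two_mul (hvol q hq)
      (measure_le_two_mul_diff hE (hfin _ _) hqA)).trans (measure_mono ?_)
    exact sdiff_subset_sdiff_left (hsub q hq)

/-- Halve the radius from `ε * d x` until the density of `E` first exceeds `1 / 2`. The last radius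
`r` before that is balanced: the complement has at least half of `B(x, r)`, and `E` more than half
of `B(x, r / 2)`. -/
theorem exists_balanced_of_density (hdpos : ∀ y, 0 < d y) (hn : 0 < n) (hcl : 0 < cl)
    (hlow : ∀ x r, 0 < r → r ≤ κ * d x → ENNReal.ofReal (cl * r ^ n) ≤ ν (closedBall x r))
    (hfin : ∀ x r, ν (closedBall x r) ≠ ⊤) (hε : 0 < ε) (hεκ : ε ≤ κ)
    (hE : MeasurableSet E) {x : Y}
    (hx : ∀ᶠ r in 𝓝[>] (0 : ℝ), ν (closedBall x r) < 2 * ν (E ∩ closedBall x r))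
    (hxA : ¬ ν (closedBall x (ε * d x)) < 2 * ν (E ∩ closedBall x (ε * d x))) :
    ∃ r, 0 < r ∧ r ≤ ε * d x ∧
      ENNReal.ofReal (cl / 2 * (1 / 4) ^ n * r ^ n) ≤ ν (E ∩ closedBall x r) ∧
      ENNReal.ofReal (cl / 2 * (1 / 4) ^ n * r ^ n) ≤ ν (closedBall x r \ E) := by
  have hdx := hdpos x
  set R := ε * d x with hR
  have hR0 : 0 < R := by positivity
  have htend : Tendsto (fun k : ℕ => R * (1 / 2 : ℝ) ^ k) atTop (𝓝[>] 0) := by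
    refine tendsto_nhdsWithin_iff.2 ⟨?_, Eventually.of_forall fun k => ?_⟩
    · simpa using (tendsto_pow_atTop_nhds_zero_of_lt_one (by norm_num : (0 : ℝ) ≤ 1 / 2)
        (by norm_num)).const_mul R
    · exact mem_Ioi.2 (by positivity)
  have hex := (htend.eventually hx).exists
  classical
  obtain ⟨hk, hmin⟩ := And.intro (Nat.find_spec hex) (fun m => Nat.find_min hex (m := m))
  set k := Nat.find hex
  have hk0 : k ≠ 0 := by
    intro h
    rw [h] at hk
    exact hxA (by simpa using hk)
  obtain ⟨j, hj⟩ := Nat.exists_eq_succ_of_ne_zero hk0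
  have hj' := hmin j (by omega)
  set r := R * (1 / 2 : ℝ) ^ j with hr
  have hr0 : 0 < r := by positivity
  have hrR : r ≤ R := by
    rw [hr]
    exact mul_le_of_le_one_right hR0.le (pow_le_one₀ (by norm_num) (by norm_num))
  have hhalf : R * (1 / 2 : ℝ) ^ k = r / 2 := by rw [hj, pow_succ, hr]; ring
  rw [hhalf] at hk
  have hRκ : R ≤ κ * d x := by rw [hR]; gcongr
  -- `1 / 2` would do here; `1 / 4` matches the constant of the frontier case.
  have hpow : (1 / 4 : ℝ) ^ n * r ^ n ≤ (r / 2) ^ n := by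
    rw [← Real.mul_rpow (by norm_num) hr0.le]
    exact Real.rpow_le_rpow (by positivity) (by linarith) hn.le
  have hpow' : (r / 2) ^ n ≤ r ^ n := Real.rpow_le_rpow (by positivity) (by linarith) hn.le
  refine ⟨r, hr0, hrR, ?_, ?_⟩
  · refine (ofReal_le_of_two_mul (le_trans (ENNReal.ofReal_le_ofReal ?_)
      (hlow x (r / 2) (by positivity) (by linarith))) hk.le).trans (measure_mono
        (inter_subset_inter_right _ (closedBall_subset_closedBall (by linarith))))
    calc 2 * (cl / 2 * (1 / 4) ^ n * r ^ n) = cl * ((1 / 4 : ℝ) ^ n * r ^ n) := by ring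
      _ ≤ _ := by gcongr
  · refine ofReal_le_of_two_mul (le_trans (ENNReal.ofReal_le_ofReal ?_)
      (hlow x r hr0 (by linarith))) (measure_le_two_mul_diff hE (hfin _ _) hj')
    calc 2 * (cl / 2 * (1 / 4) ^ n * r ^ n) = cl * ((1 / 4 : ℝ) ^ n * r ^ n) := by ring
      _ ≤ _ := by gcongr; linarith

/-- Lebesgue density for the Vitali family of `ν`. Doubling is known only for radii up to `κ * d x`,
which suffices because the family asks for it along small radii at each point. -/
theorem ae_eventually_measure_lt_two_mul [BorelSpace Y] [SecondCountableTopology Y] [IsLocallyFiniteMeasure ν]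
    (hdpos : ∀ y, 0 < d y) (hcl : 0 < cl) (hκ : 0 < κ)
    (hlow : ∀ x r, 0 < r → r ≤ κ * d x → ENNReal.ofReal (cl * r ^ n) ≤ ν (closedBall x r))
    (hcu : 0 < cu) (hup : ∀ x r, 0 < r → ν (closedBall x r) ≤ ENNReal.ofReal (cu * r ^ n))
    (E : Set Y) :
    ∀ᵐ x ∂ν.restrict E, ∀ᶠ r in 𝓝[>] (0 : ℝ),
      ν (closedBall x r) < 2 * ν (E ∩ closedBall x r) := by
  set C : NNReal := Real.toNNReal (cu * 3 ^ n / cl) with hC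
  have hdbl : ∀ x r, 0 < r → r ≤ κ * d x →
      ν (closedBall x (3 * r)) ≤ C * ν (closedBall x r) := by
    intro x r hr hrκ
    calc ν (closedBall x (3 * r)) ≤ ENNReal.ofReal (cu * (3 * r) ^ n) := hup _ _ (by positivity)
      _ = ENNReal.ofReal (cu * 3 ^ n / cl) * ENNReal.ofReal (cl * r ^ n) := by
        rw [← ENNReal.ofReal_mul (by positivity), Real.mul_rpow (by norm_num) hr.le]
        congr 1
        field_simp
      _ ≤ C * ν (closedBall x r) := by
        gcongr
        · exact le_rfl
        · exact hlow x r hr hrκ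
  have hev : ∀ x, ∀ᶠ r in 𝓝[>] (0 : ℝ), 0 < r ∧ r ≤ κ * d x := fun x =>
    Ioc_mem_nhdsGT (mul_pos hκ (hdpos x))
  let v := Vitali.vitaliFamily ν C (fun x =>
    ((hev x).mono fun r hr => hdbl x r hr.1 hr.2).frequently)
  filter_upwards [v.ae_tendsto_measure_inter_div E] with x hx
  have htend : Tendsto (fun r => closedBall x r) (𝓝[>] (0 : ℝ)) (v.filterAt x) := by
    refine (VitaliFamily.tendsto_filterAt_iff _).2 ⟨?_, fun δ hδ => ?_⟩
    · filter_upwards [hev x] with r hr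
      exact ⟨isClosed_closedBall,
        (nonempty_ball.2 hr.1).mono ball_subset_interior_closedBall, r, subset_rfl,
        hdbl x r hr.1 hr.2⟩
    · filter_upwards [Ioc_mem_nhdsGT hδ] with r hr
      exact closedBall_subset_closedBall hr.2
  have h2 := (hx.comp htend).eventually (lt_mem_nhds (show (2⁻¹ : ENNReal) < 1 by norm_num))
  filter_upwards [h2, hev x] with r hr hr0
  have hpos : ν (closedBall x r) ≠ 0 := by
    refine (lt_of_lt_of_le ?_ (hlow x r hr0.1 hr0.2)).ne'
    rw [ENNReal.ofReal_pos]
    exact mul_pos hcl (Real.rpow_pos_of_pos hr0.1 _)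
  have hfin : ν (closedBall x r) ≠ ⊤ := ne_top_of_le_ne_top ENNReal.ofReal_ne_top (hup x r hr0.1)
  simp only [Function.comp] at hr
  rw [ENNReal.lt_div_iff_mul_lt (Or.inl hpos) (Or.inl hfin)] at hr
  have h3 := (ENNReal.mul_lt_mul_iff_right (a := 2) (by norm_num) (by norm_num)).2 hr
  rwa [← mul_assoc, ENNReal.mul_inv_cancel (by norm_num) (by norm_num), one_mul] at h3

/-- If `E` prevails in `B(x, ε d(x))`, the connected set from `x` to `x₀` must cross the frontier of
the region where it does, and the crossing point `p` satisfies `dist x p ≤ cJ * d p = cJ / (2 * ε) *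
r` for `r = 2 * ε * d p`. Otherwise a ball centred at `x` itself is balanced. -/
theorem ae_exists_balanced [BorelSpace Y] [SecondCountableTopology Y] [IsLocallyFiniteMeasure ν]
    (hd : LipschitzWith 1 d) (hdpos : ∀ y, 0 < d y) (hn : 0 < n) (hcl : 0 < cl) (hcu : 0 < cu)
    (hlow : ∀ x r, 0 < r → r ≤ κ * d x → ENNReal.ofReal (cl * r ^ n) ≤ ν (closedBall x r))
    (hup : ∀ x r, 0 < r → ν (closedBall x r) ≤ ENNReal.ofReal (cu * r ^ n))
    (hε : 0 < ε) (hε1 : ε ≤ 1) (hεκ : ε ≤ κ) {x₀ : Y} {cJ : ℝ} (hcJ : 0 < cJ)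
    (hchain : ∀ x, ∃ S : Set Y, IsPreconnected S ∧ x ∈ S ∧ x₀ ∈ S ∧
      ∀ p ∈ S, dist x p ≤ cJ * d p)
    (hE : MeasurableSet E)
    (hE₀ : ¬ ν (closedBall x₀ (ε * d x₀)) < 2 * ν (E ∩ closedBall x₀ (ε * d x₀))) :
    ∀ᵐ x ∂ν.restrict E, ∃ p r, 0 < r ∧ r ≤ 2 * ε * d p ∧ dist x p ≤ cJ / (2 * ε) * r ∧
      ENNReal.ofReal (cl / 2 * (1 / 4) ^ n * r ^ n) ≤ ν (E ∩ closedBall p r) ∧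
      ENNReal.ofReal (cl / 2 * (1 / 4) ^ n * r ^ n) ≤ ν (closedBall p r \ E) := by
  have hfin : ∀ x r, ν (closedBall x r) ≠ ⊤ := fun x r =>
    ne_top_of_le_ne_top ENNReal.ofReal_ne_top
      ((measure_mono (closedBall_subset_closedBall (le_max_left r 1))).trans
        (hup x (max r 1) (by positivity)))
  filter_upwards [ae_eventually_measure_lt_two_mul hdpos hcl (hε.trans_le hεκ) hlow hcu hup E]
    with x hx
  by_cases hxA : ν (closedBall x (ε * d x)) < 2 * ν (E ∩ closedBall x (ε * d x))
  · obtain ⟨S, hS, hxS, hx₀S, hdist⟩ := hchain x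
    obtain ⟨p, hpS, hp⟩ := exists_mem_frontier_of_isPreconnected hS
      (A := {p | ν (closedBall p (ε * d p)) < 2 * ν (E ∩ closedBall p (ε * d p))})
      ⟨x, hxS, hxA⟩ ⟨x₀, hx₀S, hE₀⟩
    obtain ⟨h1, h2⟩ := balanced_of_mem_frontier hd hdpos hn hcl hlow hfin hε hε1 hεκ hE hp
    have := hdpos p
    refine ⟨p, 2 * ε * d p, by positivity, le_rfl, ?_, h1, h2⟩
    refine (hdist p hpS).trans (le_of_eq ?_)
    field_simp
  · obtain ⟨r, hr, hrε, h1, h2⟩ :=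
      exists_balanced_of_density hdpos hn hcl hlow hfin hε hεκ hE hx hxA
    refine ⟨x, r, hr, ?_, ?_, h1, h2⟩
    · nlinarith [mul_pos hε (hdpos x)]
    · rw [dist_self]
      positivity

end Balanced

/-! ### Summation of local estimates. -/

theorem tsum_rpow_le_rpow_tsum {ι : Type*} (a : ι → ENNReal) {q : ℝ} (hq : 1 ≤ q) :
    ∑' i, a i ^ q ≤ (∑' i, a i) ^ q := by
  have h : ∀ b : ENNReal, b ^ q = b * b ^ (q - 1) := by
    intro b
    conv_rhs => rw [← ENNReal.rpow_one b, ← ENNReal.rpow_mul, one_mul,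
      ← ENNReal.rpow_add_of_nonneg _ _ zero_le_one (by linarith)]
    ring_nf
  calc ∑' i, a i ^ q ≤ ∑' i, a i * (∑' i, a i) ^ (q - 1) := by
        refine ENNReal.tsum_le_tsum fun i => ?_
        rw [h]
        gcongr
        exact ENNReal.le_tsum i
    _ = (∑' i, a i) ^ q := by rw [ENNReal.tsum_mul_right, ← h]

/-- Adding up local estimates over a Vitali subfamily. -/
theorem measure_le_rpow_of_local {Y : Type*} [MetricSpace Y] [MeasurableSpace Y] [BorelSpace Y]
    [SecondCountableTopology Y] {ν ω : Measure Y} (hων : ω ≪ ν) {E : Set Y} {g : Y → ENNReal}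
    {C : ENNReal} {q c₀ R : ℝ} (hq : 1 ≤ q) (hc₀ : 0 ≤ c₀) (hE : MeasurableSet E)
    (h : ∀ᵐ x ∂ν.restrict E, ∃ p r, 0 < r ∧ r ≤ R ∧ dist x p ≤ c₀ * r ∧
      ω (closedBall p ((2 * c₀ + 3) * r)) ≤ (C * ∫⁻ y in closedBall p r, g y ∂ν) ^ q) :
    ω E ≤ (C * ∫⁻ y, g y ∂ν) ^ q := by
  set T := {x | ∃ p r, 0 < r ∧ r ≤ R ∧ dist x p ≤ c₀ * r ∧
    ω (closedBall p ((2 * c₀ + 3) * r)) ≤ (C * ∫⁻ y in closedBall p r, g y ∂ν) ^ q} with hT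
  have hET : ω E ≤ ω T := by
    refine measure_mono_ae ?_
    have := hων.ae_le ((ae_restrict_iff' hE).1 h)
    filter_upwards [this] with x hx hxE using hx hxE
  choose! p r hr hrR hxp hloc using fun x (hx : x ∈ T) => hx
  obtain ⟨u, huT, hdisj, hcov⟩ := Vitali.exists_disjoint_subfamily_covering_enlargement
    (fun x => closedBall (p x) (r x)) T r 2 (by norm_num) (fun x hx => (hr x hx).le) R hrR
    (fun x hx => ⟨p x, mem_closedBall_self (hr x hx).le⟩)
  have hcount : u.Countable := hdisj.countable_of_nonempty_interior fun x hx =>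
    (nonempty_ball.2 (hr x (huT hx))).mono ball_subset_interior_closedBall
  have := hcount.to_subtype
  -- The selected ball meets `B(p x, r x)` and `r x ≤ 2 * r b`, so `dist x (p b) ≤ c₀ * r x + r x +
  -- r b ≤ (2 * c₀ + 3) * r b`.
  have hsub : T ⊆ ⋃ b : u, closedBall (p b) ((2 * c₀ + 3) * r b) := by
    intro x hx
    obtain ⟨b, hb, ⟨z, hzx, hzb⟩, hrb⟩ := hcov x hx
    refine mem_iUnion.2 ⟨⟨b, hb⟩, ?_⟩
    rw [mem_closedBall] at *
    have h1 := dist_triangle x (p x) z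
    have h2 := dist_triangle x z (p b)
    have h3 := hxp x hx
    rw [dist_comm] at hzx
    have h4 : c₀ * r x ≤ c₀ * (2 * r b) := by gcongr
    linarith
  calc ω E ≤ ω T := hET
    _ ≤ ω (⋃ b : u, closedBall (p b) ((2 * c₀ + 3) * r b)) := measure_mono hsub
    _ ≤ ∑' b : u, ω (closedBall (p b) ((2 * c₀ + 3) * r b)) := measure_iUnion_le _
    _ ≤ ∑' b : u, (C * ∫⁻ y in closedBall (p b) (r b), g y ∂ν) ^ q :=
        ENNReal.tsum_le_tsum fun b => hloc b (huT b.2)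
    _ ≤ (∑' b : u, C * ∫⁻ y in closedBall (p b) (r b), g y ∂ν) ^ q :=
        tsum_rpow_le_rpow_tsum _ hq
    _ = (C * ∫⁻ y in ⋃ b : u, closedBall (p b) (r b), g y ∂ν) ^ q := by
        rw [ENNReal.tsum_mul_left, lintegral_iUnion (fun b => isClosed_closedBall.measurableSet)]
        intro a b hab
        exact hdisj a.2 b.2 fun h => hab (Subtype.ext h)
    _ ≤ (C * ∫⁻ y, g y ∂ν) ^ q := by
        gcongr
        exact Measure.restrict_le_self

/-! ### The nonlocal perimeter and its isoperimetric inequality. -/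

section Perimeter



theorem exists_forall_le_mul_of_doubling {φ : ℝ → ℝ} (hφpos : ∀ t : ℝ, 0 < t → 0 < φ t)
    (hφmono : MonotoneOn φ (Ioi 0)) {K : ℝ} (hK : ∀ t : ℝ, 0 < t → φ (2 * t) ≤ K * φ t)
    {M : ℝ} (hM : 0 < M) : ∃ A : ℝ, 0 < A ∧ ∀ t : ℝ, 0 < t → φ (M * t) ≤ A * φ t := by
  have hK0 : 0 < K := by
    have h1 := hφpos 1 one_pos
    have h2 := hφpos (2 * 1) (by norm_num)
    have h3 := hK 1 one_pos
    by_contra h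
    nlinarith
  have hpow : ∀ (m : ℕ) (t : ℝ), 0 < t → φ (2 ^ m * t) ≤ K ^ m * φ t := by
    intro m
    induction m with
    | zero => simp
    | succ m ih =>
      intro t ht
      calc φ (2 ^ (m + 1) * t) = φ (2 * (2 ^ m * t)) := by ring_nf
        _ ≤ K * φ (2 ^ m * t) := hK _ (by positivity)
        _ ≤ K * (K ^ m * φ t) := by gcongr; exact ih t ht
        _ = K ^ (m + 1) * φ t := by ring
  obtain ⟨m, hm⟩ := pow_unbounded_of_one_lt M (by norm_num : (1 : ℝ) < 2)
  refine ⟨K ^ m, by positivity, fun t ht => le_trans (hφmono ?_ ?_ ?_) (hpow m t ht)⟩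
  · exact mem_Ioi.2 (by positivity)
  · exact mem_Ioi.2 (by positivity)
  · gcongr

/-- The double integral of a kernel over the pairs of points separated by `E`. -/
def kernelPerimeter {Y : Type*} [MeasurableSpace Y] (ν : Measure Y) (k : Y → Y → ENNReal) (E : Set Y) :
    ENNReal :=
  ∫⁻ y, ∫⁻ z, {z | ¬(z ∈ E ↔ y ∈ E)}.indicator (fun z => k z y) z ∂ν ∂ν

variable {Y : Type*} [MetricSpace Y]

/-- The kernel `v(z, y) / (cu * dist z y ^ m)`, cut off at `dist z y ≤ τ * d y`. -/
def truncKernel (d ρ : Y → ℝ) (Φ : ℝ → ℝ) (γ τ cu m : ℝ) (z y : Y) : ENNReal :=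
  {z | dist z y ≤ τ * d y}.indicator
    (fun z => ENNReal.ofReal (min (d z ^ γ * Φ (ρ z)) (d y ^ γ * Φ (ρ y))) /
      ENNReal.ofReal (cu * dist z y ^ m)) z

/-- Since `r ≤ d p / 4`, both `d` and `ρ` are bounded below on the ball by a fraction of their
values at `p`. Pairs survive the truncation because `2 * r ≤ τ / 2 * d p` while `τ * d y ≥ 3 / 4 * τ
* d p`. -/
theorem truncKernel_ge {d ρ : Y → ℝ} {φ : ℝ → ℝ} {n s γ τ cu ε q : ℝ}
    (hd : LipschitzWith 1 d) (hdpos : ∀ y, 0 < d y) (hρ : LipschitzWith 1 ρ)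
    (hdρ : ∀ y, d y ≤ ρ y) (hφpos : ∀ t : ℝ, 0 < t → 0 < φ t) (hφmono : MonotoneOn φ (Ioi 0))
    (hn : 0 < n) (hs : 0 < s) (hτ : τ < 1) (hγ : 0 ≤ γ) (hq : 0 < q) (hcu : 0 < cu)
    (hε : 0 < ε) (hετ : ε ≤ τ / 8) {p z y : Y} {r : ℝ} (hr : 0 < r) (hrε : r ≤ 2 * ε * d p)
    (hz : dist z p ≤ r) (hy : dist y p ≤ r) :
    ENNReal.ofReal ((r ^ γ * φ (ρ p / 2) ^ (1 / q)) / (cu * (2 * r) ^ (n + s))) ≤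
      truncKernel d ρ (fun t => φ t ^ (1 / q)) γ τ cu (n + s) z y := by
  have hdp := hdpos p
  have hrp : r ≤ d p / 4 := by nlinarith
  have hlipd : ∀ x, dist x p ≤ r → 3 / 4 * d p ≤ d x := by
    intro x hx
    have := hd.dist_le_mul x p
    rw [Real.dist_eq] at this
    simp only [NNReal.coe_one, one_mul] at this
    have := (abs_le.1 (this.trans hx)).1
    linarith
  have hlipρ : ∀ x, dist x p ≤ r → ρ p / 2 ≤ ρ x := by
    intro x hx
    have := hρ.dist_le_mul x p
    rw [Real.dist_eq] at this
    simp only [NNReal.coe_one, one_mul] at this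
    have := (abs_le.1 (this.trans hx)).1
    linarith [hdρ p]
  have hρp : 0 < ρ p / 2 := by linarith [hdρ p]
  have hzy : dist z y ≤ 2 * r := by
    have := dist_triangle_right z y p
    linarith
  have hmem : dist z y ≤ τ * d y := by
    have h1 := hlipd y hy
    have h2 : 2 * r ≤ τ / 2 * d p := by nlinarith
    have h3 : τ * (3 / 4 * d p) ≤ τ * d y := by
      refine mul_le_mul_of_nonneg_left h1 (by linarith)
    have h4 : 0 ≤ τ * d p := mul_nonneg (by linarith) hdp.le
    linarith
  have hφ0 := hφpos _ hρp
  have hv : ∀ x, dist x p ≤ r →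
      r ^ γ * φ (ρ p / 2) ^ (1 / q) ≤ d x ^ γ * φ (ρ x) ^ (1 / q) := by
    intro x hx
    have h1 := hlipd x hx
    have h2 := hlipρ x hx
    have h3 : φ (ρ p / 2) ≤ φ (ρ x) := hφmono (mem_Ioi.2 hρp) (mem_Ioi.2 (by linarith)) h2
    have h4 := hdpos x
    gcongr
    linarith
  rw [truncKernel, indicator_of_mem (by exact hmem), ENNReal.ofReal_div_of_pos (by positivity)]
  gcongr
  exact le_min (hv z hz) (hv y hy)

variable [MeasurableSpace Y] [BorelSpace Y] {ν : Measure Y}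

/-- With `φ₀ = φ (ρ p / 2)`, the weighted measure is at most a multiple of `φ₀ * r ^ n`, and the
double integral over `(E ∩ B) × (B \ E)` is at least a multiple of `φ₀ ^ (1 / q) * r ^ (γ - n - s) *
r ^ (2 * n)`. The `q`-th power of the latter is `φ₀ * r ^ n`. -/
theorem exists_measure_ball_le_of_balanced {d ρ : Y → ℝ} {φ : ℝ → ℝ} {n s γ τ cu ε c M : ℝ}
    (hd : LipschitzWith 1 d) (hdpos : ∀ y, 0 < d y) (hρ : LipschitzWith 1 ρ)
    (hdρ : ∀ y, d y ≤ ρ y) (hφpos : ∀ t : ℝ, 0 < t → 0 < φ t) (hφmono : MonotoneOn φ (Ioi 0))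
    {K : ℝ} (hK : ∀ t : ℝ, 0 < t → φ (2 * t) ≤ K * φ t)
    (hn : 0 < n) (hs : 0 < s) (hτ : τ < 1) (hγ : 0 ≤ γ) (hsn : s - γ < n) (hcu : 0 < cu)
    (hε : 0 < ε) (hετ : ε ≤ τ / 8) (hc : 0 < c) (hM : 0 < M)
    (hup : ∀ x r, 0 < r → ν (closedBall x r) ≤ ENNReal.ofReal (cu * r ^ n)) :
    ∃ C : ℝ, 0 < C ∧ ∀ E : Set Y, MeasurableSet E → ∀ (p : Y) (r : ℝ), 0 < r →
      r ≤ 2 * ε * d p →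
      ENNReal.ofReal (c * r ^ n) ≤ ν (E ∩ closedBall p r) →
      ENNReal.ofReal (c * r ^ n) ≤ ν (closedBall p r \ E) →
      (ν.withDensity fun y => ENNReal.ofReal (φ (ρ y))) (closedBall p (M * r)) ≤
        (ENNReal.ofReal C * ∫⁻ y in closedBall p r, ∫⁻ z, {z | ¬(z ∈ E ↔ y ∈ E)}.indicator
          (fun z => truncKernel d ρ (fun t => φ t ^ (1 / (n / (n - (s - γ))))) γ τ cu (n + s) z y)
            z ∂ν ∂ν) ^ (n / (n - (s - γ))) := by
  set q := n / (n - (s - γ)) with hqdef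
  have hq : 0 < q := div_pos hn (by linarith)
  -- On `B(p, M * r)` one has `ρ y ≤ ρ p + M * r ≤ (2 + M) * (ρ p / 2)`.
  obtain ⟨A, hA, hAφ⟩ := exists_forall_le_mul_of_doubling hφpos hφmono hK
    (by positivity : 0 < 2 + M)
  refine ⟨(A * cu * M ^ n) ^ (1 / q) * (cu * 2 ^ (n + s)) / c ^ 2, by positivity, ?_⟩
  intro E hE p r hr hrε h1 h2
  have hdp := hdpos p
  have hrp : r ≤ d p / 4 := by nlinarith
  have hρp : 0 < ρ p / 2 := by linarith [hdρ p]
  set φ₀ := φ (ρ p / 2) with hφ₀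
  have hφ0 : 0 < φ₀ := hφpos _ hρp
  have hupper : (ν.withDensity fun y => ENNReal.ofReal (φ (ρ y))) (closedBall p (M * r)) ≤
      ENNReal.ofReal (A * φ₀ * (cu * (M * r) ^ n)) := by
    rw [withDensity_apply _ isClosed_closedBall.measurableSet]
    calc ∫⁻ y in closedBall p (M * r), ENNReal.ofReal (φ (ρ y)) ∂ν
        ≤ ∫⁻ _ in closedBall p (M * r), ENNReal.ofReal (A * φ₀) ∂ν := by
          refine setLIntegral_mono' isClosed_closedBall.measurableSet fun y hy => ?_
          refine ENNReal.ofReal_le_ofReal (le_trans (hφmono ?_ ?_ ?_) (hAφ _ hρp))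
          · exact mem_Ioi.2 ((hdpos y).trans_le (hdρ y))
          · exact mem_Ioi.2 (by positivity)
          · have := hρ.dist_le_mul y p
            rw [Real.dist_eq] at this
            simp only [NNReal.coe_one, one_mul] at this
            have := (abs_le.1 (this.trans (mem_closedBall.1 hy))).2
            have : M * r ≤ M * (ρ p / 4) := by gcongr; linarith [hdρ p]
            have : 0 ≤ M * ρ p := by nlinarith
            nlinarith
      _ = ENNReal.ofReal (A * φ₀) * ν (closedBall p (M * r)) := setLIntegral_const _ _
      _ ≤ ENNReal.ofReal (A * φ₀) * ENNReal.ofReal (cu * (M * r) ^ n) := by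
          gcongr
          exact hup _ _ (by positivity)
      _ = _ := (ENNReal.ofReal_mul (by positivity)).symm
  set K₀ := (r ^ γ * φ₀ ^ (1 / q)) / (cu * (2 * r) ^ (n + s)) with hK₀
  have hlower : ENNReal.ofReal (K₀ * (c * r ^ n) * (c * r ^ n)) ≤
      ∫⁻ y in closedBall p r, ∫⁻ z, {z | ¬(z ∈ E ↔ y ∈ E)}.indicator
          (fun z => truncKernel d ρ (fun t => φ t ^ (1 / q)) γ τ cu (n + s) z y) z ∂ν ∂ν := by
    have hB : MeasurableSet (closedBall p r) := isClosed_closedBall.measurableSet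
    calc ENNReal.ofReal (K₀ * (c * r ^ n) * (c * r ^ n))
        = ENNReal.ofReal K₀ * ENNReal.ofReal (c * r ^ n) * ENNReal.ofReal (c * r ^ n) := by
          rw [ENNReal.ofReal_mul (by positivity), ENNReal.ofReal_mul (by positivity)]
      _ ≤ ENNReal.ofReal K₀ * ν (closedBall p r \ E) * ν (E ∩ closedBall p r) := by gcongr
      _ = ∫⁻ _ in E ∩ closedBall p r, ∫⁻ _ in closedBall p r \ E, ENNReal.ofReal K₀ ∂ν ∂ν := by
          rw [setLIntegral_const, setLIntegral_const]
      _ ≤ ∫⁻ y in E ∩ closedBall p r, ∫⁻ z, {z | ¬(z ∈ E ↔ y ∈ E)}.indicator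
          (fun z => truncKernel d ρ (fun t => φ t ^ (1 / q)) γ τ cu (n + s) z y) z ∂ν ∂ν := by
          refine setLIntegral_mono' (hE.inter hB) fun y hy => ?_
          refine le_trans (setLIntegral_mono' (hB.diff hE) fun z hz => ?_)
            (setLIntegral_le_lintegral (closedBall p r \ E) _)
          rw [indicator_of_mem (show z ∈ {z | ¬(z ∈ E ↔ y ∈ E)} from
            fun h => hz.2 (h.2 hy.1))]
          exact truncKernel_ge hd hdpos hρ hdρ hφpos hφmono hn hs hτ hγ hq hcu hε hετ hr hrε
            (mem_closedBall.1 hz.1) (mem_closedBall.1 hy.2)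
      _ ≤ _ := lintegral_mono_set inter_subset_right
  refine hupper.trans ?_
  have hfinal : (A * φ₀ * (cu * (M * r) ^ n)) =
      ((A * cu * M ^ n) ^ (1 / q) * (cu * 2 ^ (n + s)) / c ^ 2 *
        (K₀ * (c * r ^ n) * (c * r ^ n))) ^ q := by
    -- The scaling identity that dictates the exponent: `n / q = n - (s - γ)`.
    have hr1 : r ^ n * r ^ n * r ^ γ / r ^ (n + s) = (r ^ n) ^ (1 / q) := by
      rw [← Real.rpow_mul hr.le, ← Real.rpow_add hr, ← Real.rpow_add hr, ← Real.rpow_sub hr]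
      congr 1
      rw [hqdef]
      have : n - (s - γ) ≠ 0 := by linarith
      field_simp
      ring
    have : (A * cu * M ^ n) ^ (1 / q) * (cu * 2 ^ (n + s)) / c ^ 2 *
        (K₀ * (c * r ^ n) * (c * r ^ n)) = (A * φ₀ * (cu * (M * r) ^ n)) ^ (1 / q) := by
      have hT : 0 < A * cu * M ^ n := by positivity
      rw [hK₀, Real.mul_rpow (by norm_num : (0 : ℝ) ≤ 2) hr.le, Real.mul_rpow hM.le hr.le]
      have e : A * φ₀ * (cu * (M ^ n * r ^ n)) = (A * cu * M ^ n) * φ₀ * r ^ n := by ring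
      rw [e, Real.mul_rpow (mul_nonneg hT.le hφ0.le) (by positivity),
        Real.mul_rpow hT.le hφ0.le, ← hr1]
      generalize (A * cu * M ^ n) ^ (1 / q) = T
      have h2 : (2 : ℝ) ^ (n + s) ≠ 0 := by positivity
      have h3 : r ^ (n + s) ≠ 0 := by positivity
      field_simp
    rw [this, ← Real.rpow_mul (by positivity), one_div_mul_cancel hq.ne', Real.rpow_one]
  rw [hfinal, ← ENNReal.ofReal_rpow_of_nonneg (by positivity) hq.le,
    ENNReal.ofReal_mul (by positivity)]
  gcongr

/-- The weighted relative isoperimetric inequality for the nonlocal perimeter. -/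
theorem exists_measure_le_kernelPerimeter [SecondCountableTopology Y] [IsLocallyFiniteMeasure ν]
    {d ρ : Y → ℝ} {φ : ℝ → ℝ} {n s γ τ cl cu κ ε cJ : ℝ}
    (hd : LipschitzWith 1 d) (hdpos : ∀ y, 0 < d y) (hρ : LipschitzWith 1 ρ)
    (hdρ : ∀ y, d y ≤ ρ y) (hφpos : ∀ t : ℝ, 0 < t → 0 < φ t) (hφmono : MonotoneOn φ (Ioi 0))
    (hφdbl : ∃ K : ℝ, ∀ t : ℝ, 0 < t → φ (2 * t) ≤ K * φ t)
    (hn : 0 < n) (hs : 0 < s) (hτ : τ < 1) (hγ : 0 ≤ γ) (hγs : γ < s) (hsn : s - γ < n)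
    (hcl : 0 < cl) (hcu : 0 < cu)
    (hlow : ∀ x r, 0 < r → r ≤ κ * d x → ENNReal.ofReal (cl * r ^ n) ≤ ν (closedBall x r))
    (hup : ∀ x r, 0 < r → ν (closedBall x r) ≤ ENNReal.ofReal (cu * r ^ n))
    (hε : 0 < ε) (hετ : ε ≤ τ / 8) (hεκ : ε ≤ κ) {x₀ : Y} (hcJ : 0 < cJ)
    (hchain : ∀ x, ∃ S : Set Y, IsPreconnected S ∧ x ∈ S ∧ x₀ ∈ S ∧
      ∀ p ∈ S, dist x p ≤ cJ * d p) :
    ∃ C : ℝ, 0 < C ∧ ∀ E : Set Y, MeasurableSet E →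
      ¬ ν (closedBall x₀ (ε * d x₀)) < 2 * ν (E ∩ closedBall x₀ (ε * d x₀)) →
      (ν.withDensity fun y => ENNReal.ofReal (φ (ρ y))) E ≤
        (ENNReal.ofReal C * kernelPerimeter ν
          (truncKernel d ρ (fun t => φ t ^ (1 / (n / (n - (s - γ))))) γ τ cu (n + s)) E) ^
            (n / (n - (s - γ))) := by
  obtain ⟨K, hK⟩ := hφdbl
  have hc₀ : 0 ≤ cJ / (2 * ε) := by positivity
  obtain ⟨C, hC, hloc⟩ := exists_measure_ball_le_of_balanced (ν := ν)
    (c := cl / 2 * (1 / 4) ^ n) (M := 2 * (cJ / (2 * ε)) + 3) hd hdpos hρ hdρ hφpos hφmono hK hn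
    hs hτ hγ hsn hcu hε hετ (by positivity) (by positivity) hup
  refine ⟨C, hC, fun E hE hE₀ => ?_⟩
  -- The Vitali selection needs bounded radii: the chain from `p` gives `dist p x₀ ≤ cJ * d x₀`,
  -- hence `d p ≤ d x₀ + cJ * d x₀`.
  refine measure_le_rpow_of_local (R := 2 * ε * (d x₀ + cJ * d x₀)) (c₀ := cJ / (2 * ε))
    (withDensity_absolutelyContinuous _ _) ?_ hc₀ hE ?_
  · rw [le_div_iff₀ (by linarith)]
    linarith
  filter_upwards [ae_exists_balanced hd hdpos hn hcl hcu hlow hup hε (by linarith) hεκ hcJ hchain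
    hE hE₀] with x hx
  obtain ⟨p, r, hr, hrε, hdist, h1, h2⟩ := hx
  refine ⟨p, r, hr, hrε.trans ?_, hdist, hloc E hE p r hr hrε h1 h2⟩
  obtain ⟨S, -, -, hx₀S, hS⟩ := hchain p
  have h3 := hS x₀ hx₀S
  have h4 := hd.dist_le_mul p x₀
  rw [Real.dist_eq] at h4
  simp only [NNReal.coe_one, one_mul] at h4
  have := (abs_le.1 (h4.trans h3)).2
  gcongr
  linarith

end Perimeter

/-! ### From isoperimetric to Sobolev–Poincaré inequalities. -/

section Coarea

variable {Y : Type*} [MeasurableSpace Y]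

/-- Layer cake, with `t * ω {f > t} ^ (1 / q) ≤ H` because the superlevel measure decreases in `t`;
this trades `t ^ (q - 1)` for `H ^ (q - 1)`. -/
theorem lintegral_rpow_le_of_superlevel {ω : Measure Y} {f : Y → ℝ} (hf : Measurable f)
    (hf0 : ∀ y, 0 ≤ f y) {q : ℝ} (hq : 1 ≤ q) :
    ∫⁻ y, ENNReal.ofReal (f y ^ q) ∂ω ≤
      ENNReal.ofReal q * (∫⁻ t in Ioi (0 : ℝ), ω {y | t < f y} ^ (1 / q)) ^ q := by
  have hq0 : 0 < q := by linarith
  set H := ∫⁻ t in Ioi (0 : ℝ), ω {y | t < f y} ^ (1 / q) with hH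
  have hanti : Antitone fun t : ℝ => ω {y | t < f y} ^ (1 / q) := fun a b hab =>
    ENNReal.rpow_le_rpow (measure_mono fun y hy => hab.trans_lt hy) (by positivity)
  have hsplit : ∀ b : ENNReal, b ^ q = b * b ^ (q - 1) := by
    intro b
    conv_rhs => rw [← ENNReal.rpow_one b, ← ENNReal.rpow_mul, one_mul,
      ← ENNReal.rpow_add_of_nonneg _ _ zero_le_one (by linarith)]
    ring_nf
  rw [lintegral_rpow_eq_lintegral_meas_lt_mul ω (Eventually.of_forall hf0) hf.aemeasurable hq0]
  gcongr
  have hpt : ∀ t ∈ Ioi (0 : ℝ), ω {y | t < f y} * ENNReal.ofReal (t ^ (q - 1)) ≤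
      ω {y | t < f y} ^ (1 / q) * H ^ (q - 1) := by
    intro t ht
    have h1 : ω {y | t < f y} ^ (1 / q) * ENNReal.ofReal t ≤ H := by
      calc ω {y | t < f y} ^ (1 / q) * ENNReal.ofReal t
          = ∫⁻ _ in Ioc 0 t, ω {y | t < f y} ^ (1 / q) := by simp
        _ ≤ ∫⁻ t' in Ioc 0 t, ω {y | t' < f y} ^ (1 / q) :=
            setLIntegral_mono' measurableSet_Ioc fun t' ht' => hanti ht'.2
        _ ≤ H := lintegral_mono_set Ioc_subset_Ioi_self
    have h2 : ω {y | t < f y} = (ω {y | t < f y} ^ (1 / q)) ^ q := by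
      rw [← ENNReal.rpow_mul, one_div_mul_cancel hq0.ne', ENNReal.rpow_one]
    conv_lhs => rw [h2, hsplit]
    rw [← ENNReal.ofReal_rpow_of_pos ht, mul_assoc,
      ← ENNReal.mul_rpow_of_nonneg _ _ (by linarith)]
    gcongr
  calc _ ≤ ∫⁻ t in Ioi (0 : ℝ), ω {y | t < f y} ^ (1 / q) * H ^ (q - 1) :=
        setLIntegral_mono' measurableSet_Ioi hpt
    _ = H * H ^ (q - 1) := lintegral_mul_const _ hanti.measurable
    _ = H ^ q := (hsplit H).symm

/-- Coarea by Tonelli: `{u > t}` separates `y` and `z` exactly for `t` in an interval of length `|u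
z - u y|`. -/
theorem lintegral_kernelPerimeter_le {ν : Measure Y} [SFinite ν] {k : Y → Y → ENNReal}
    (hk : Measurable (Function.uncurry k)) {u : Y → ℝ} (hu : Measurable u) :
    ∫⁻ t in Ioi (0 : ℝ), kernelPerimeter ν k {x | t < u x} ≤
      ∫⁻ y, ∫⁻ z, ENNReal.ofReal |u z - u y| * k z y ∂ν ∂ν := by
  set S : Set (ℝ × (Y × Y)) := {x | ¬(x.1 < u x.2.2 ↔ x.1 < u x.2.1)} with hS
  have hSm : MeasurableSet S := by
    have h1 : MeasurableSet {x : ℝ × (Y × Y) | x.1 < u x.2.2} :=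
      measurableSet_lt (by fun_prop) (by fun_prop)
    have h2 : MeasurableSet {x : ℝ × (Y × Y) | x.1 < u x.2.1} :=
      measurableSet_lt (by fun_prop) (by fun_prop)
    exact (h1.iff h2).compl
  have hk' : Measurable fun p : Y × Y => k p.2 p.1 := hk.comp measurable_swap
  set G : ℝ × (Y × Y) → ENNReal := S.indicator fun x => k x.2.2 x.2.1 with hG
  have hGm : Measurable G := (hk'.comp measurable_snd).indicator hSm
  have h1 : ∀ t : ℝ, kernelPerimeter ν k {x | t < u x} = ∫⁻ p, G (t, p) ∂(ν.prod ν) := by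
    intro t
    exact (lintegral_prod (fun p => G (t, p))
      (hGm.comp measurable_prodMk_left).aemeasurable).symm
  have h2 : ∀ p : Y × Y, ∫⁻ t in Ioi (0 : ℝ), G (t, p) ≤
      ENNReal.ofReal |u p.2 - u p.1| * k p.2 p.1 := by
    intro p
    have hle : ∀ t : ℝ, G (t, p) ≤
        (Ico (min (u p.1) (u p.2)) (max (u p.1) (u p.2))).indicator (fun _ => k p.2 p.1) t := by
      intro t
      by_cases ht : (t, p) ∈ S
      · have : t ∈ Ico (min (u p.1) (u p.2)) (max (u p.1) (u p.2)) := by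
          simp only [hS, mem_ofPred_eq] at ht
          simp only [mem_Ico, min_le_iff, lt_max_iff]
          by_cases h1 : t < u p.1 <;> by_cases h2 : t < u p.2 <;>
            simp_all [le_of_not_gt]
        rw [hG, indicator_of_mem ht, indicator_of_mem this]
      · rw [hG, indicator_of_notMem ht]
        exact zero_le
    calc ∫⁻ t in Ioi (0 : ℝ), G (t, p) ≤ ∫⁻ t, G (t, p) := setLIntegral_le_lintegral _ _
      _ ≤ ∫⁻ t, (Ico (min (u p.1) (u p.2)) (max (u p.1) (u p.2))).indicator
            (fun _ => k p.2 p.1) t := lintegral_mono hle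
      _ = ENNReal.ofReal |u p.2 - u p.1| * k p.2 p.1 := by
          rw [lintegral_indicator measurableSet_Ico, setLIntegral_const, Real.volume_Ico, mul_comm,
            max_sub_min_eq_abs]
  calc _ = ∫⁻ t in Ioi (0 : ℝ), ∫⁻ p, G (t, p) ∂(ν.prod ν) := lintegral_congr fun t => h1 t
    _ = ∫⁻ p, (∫⁻ t in Ioi (0 : ℝ), G (t, p)) ∂(ν.prod ν) :=
        lintegral_lintegral_swap hGm.aemeasurable
    _ ≤ ∫⁻ p, ENNReal.ofReal |u p.2 - u p.1| * k p.2 p.1 ∂(ν.prod ν) := lintegral_mono h2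
    _ = _ := lintegral_prod _ (by fun_prop)

theorem two_mul_measure_iUnion_le {m : Measure Y} {S : ℕ → Set Y} (hS : Monotone S)
    {b : ENNReal} (h : ∀ k, 2 * m (S k) ≤ b) : 2 * m (⋃ k, S k) ≤ b := by
  rw [hS.measure_iUnion, ENNReal.mul_iSup]
  exact iSup_le h

/-- The median is the least level above which at most half the mass lies; continuity from below
along levels approaching it handles both strict inequalities. -/
theorem exists_median {m : Measure Y} [IsFiniteMeasure m] (hm : m univ ≠ 0) {u : Y → ℝ}
    (hu : Measurable u) :
    ∃ a : ℝ, 2 * m {y | a < u y} ≤ m univ ∧ 2 * m {y | u y < a} ≤ m univ := by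
  have hhalf : ∀ t : ℝ, ¬ 2 * m {y | t < u y} ≤ m univ → 2 * m {y | u y ≤ t} ≤ m univ := by
    intro t ht
    have h1 : MeasurableSet {y | t < u y} := measurableSet_lt measurable_const hu
    have h2 := measure_add_measure_compl h1 (μ := m)
    have h3 : {y | t < u y}ᶜ = {y | u y ≤ t} := by ext; simp
    rw [h3] at h2
    have h4 : m {y | t < u y} ≠ ⊤ := measure_ne_top _ _
    have h5 : m {y | u y ≤ t} ≠ ⊤ := measure_ne_top _ _
    rw [← h2] at ht ⊢
    lift m {y | t < u y} to NNReal using h4 with a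
    lift m {y | u y ≤ t} to NNReal using h5 with b
    norm_cast at ht ⊢
    have ht' : ¬ ((2 * a : ℝ) ≤ a + b) := by exact_mod_cast ht
    have : (2 * b : ℝ) ≤ a + b := by linarith
    exact_mod_cast this
  have hcontra : ∀ {S : ℕ → Set Y}, Monotone S → (∀ k, 2 * m (S k) ≤ m univ) →
      (⋃ k, S k) ≠ univ := by
    intro S hS h hU
    have := two_mul_measure_iUnion_le hS h
    rw [hU, two_mul] at this
    have hfin : m univ ≠ ⊤ := measure_ne_top _ _
    exact absurd this (not_le.2 (ENNReal.lt_add_right hfin hm))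
  set T := {t : ℝ | 2 * m {y | t < u y} ≤ m univ} with hT
  have hup : ∀ {t t' : ℝ}, t ∈ T → t ≤ t' → t' ∈ T := fun ht htt' =>
    le_trans (mul_le_mul_right (measure_mono fun y hy => lt_of_le_of_lt htt' hy) 2) ht
  have hne : T.Nonempty := by
    by_contra hemp
    refine hcontra (S := fun k : ℕ => {y | u y ≤ k}) (fun i j hij y hy => ?_)
      (fun k => hhalf k fun h => hemp ⟨k, h⟩) (eq_univ_of_forall fun y => mem_iUnion.2 ?_)
    · have : (i : ℝ) ≤ j := by exact_mod_cast hij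
      simp only [mem_ofPred_eq] at hy ⊢
      linarith
    · exact exists_nat_ge (u y)
  have hbdd : BddBelow T := by
    by_contra hunb
    have hall : ∀ t, t ∈ T := by
      intro t
      rw [not_bddBelow_iff] at hunb
      obtain ⟨t', ht', htt'⟩ := hunb t
      exact hup ht' htt'.le
    refine hcontra (S := fun k : ℕ => {y | -(k : ℝ) < u y}) (fun i j hij y hy => ?_)
      (fun k => hall _) (eq_univ_of_forall fun y => mem_iUnion.2 ?_)
    · have : (i : ℝ) ≤ j := by exact_mod_cast hij
      simp only [mem_ofPred_eq] at hy ⊢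
      linarith
    · obtain ⟨k, hk⟩ := exists_nat_gt (-u y)
      exact ⟨k, by simp only [mem_ofPred_eq]; linarith⟩
  have hinv : ∀ {i j : ℕ}, i ≤ j → 1 / ((j : ℝ) + 1) ≤ 1 / ((i : ℝ) + 1) := fun hij =>
    Nat.one_div_le_one_div hij
  refine ⟨sInf T, ?_, ?_⟩
  · have hU : {y | sInf T < u y} = ⋃ k : ℕ, {y | sInf T + 1 / ((k : ℝ) + 1) < u y} := by
      ext y
      simp only [mem_ofPred_eq, mem_iUnion]
      constructor
      · intro h
        obtain ⟨k, hk⟩ := exists_nat_one_div_lt (sub_pos.2 h)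
        exact ⟨k, by linarith⟩
      · rintro ⟨k, hk⟩
        have : 0 < 1 / ((k : ℝ) + 1) := Nat.one_div_pos_of_nat
        linarith
    rw [hU]
    refine two_mul_measure_iUnion_le (fun i j hij y hy => ?_) fun k => ?_
    · simp only [mem_ofPred_eq] at hy ⊢
      linarith [hinv hij]
    · obtain ⟨t, ht, htk⟩ := exists_lt_of_csInf_lt hne
        (lt_add_of_pos_right (sInf T) (Nat.one_div_pos_of_nat (n := k)))
      exact hup ht htk.le
  · have hU : {y | u y < sInf T} = ⋃ k : ℕ, {y | u y ≤ sInf T - 1 / ((k : ℝ) + 1)} := by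
      ext y
      simp only [mem_ofPred_eq, mem_iUnion]
      constructor
      · intro h
        obtain ⟨k, hk⟩ := exists_nat_one_div_lt (sub_pos.2 h)
        exact ⟨k, by linarith⟩
      · rintro ⟨k, hk⟩
        have : 0 < 1 / ((k : ℝ) + 1) := Nat.one_div_pos_of_nat
        linarith
    rw [hU]
    refine two_mul_measure_iUnion_le (fun i j hij y hy => ?_) fun k => hhalf _ fun h => ?_
    · simp only [mem_ofPred_eq] at hy ⊢
      linarith [hinv hij]
    · have h1 := csInf_le hbdd h
      have : 0 < 1 / ((k : ℝ) + 1) := Nat.one_div_pos_of_nat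
      linarith

theorem eLpNorm_max_zero_le_of_isoperimetric {ν ω : Measure Y} [SFinite ν]
    {k : Y → Y → ENNReal} (hk : Measurable (Function.uncurry k)) {q : ℝ} (hq : 1 ≤ q)
    {C : ENNReal} (hC : C ≠ ⊤) {u : Y → ℝ} (hu : Measurable u)
    (h : ∀ t : ℝ, 0 < t → ω {y | t < u y} ≤ (C * kernelPerimeter ν k {x | t < u x}) ^ q) :
    eLpNorm (fun y => max (u y) 0) (ENNReal.ofReal q) ω ≤
      ENNReal.ofReal q ^ (1 / q) * (C * ∫⁻ y, ∫⁻ z, ENNReal.ofReal |u z - u y| * k z y ∂ν ∂ν) := by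
  have hq0 : 0 < q := by linarith
  rw [eLpNorm_eq_lintegral_rpow_enorm_toReal (by simpa using hq0) ENNReal.ofReal_ne_top,
    ENNReal.toReal_ofReal hq0.le]
  have h1 : ∀ y, ‖max (u y) 0‖ₑ ^ q = ENNReal.ofReal ((max (u y) 0) ^ q) := by
    intro y
    rw [Real.enorm_of_nonneg (le_max_right _ _),
      ENNReal.ofReal_rpow_of_nonneg (le_max_right _ _) hq0.le]
  simp only [h1]
  have h2 := lintegral_rpow_le_of_superlevel (ω := ω) (hu.max measurable_const)
    (fun y => le_max_right (u y) (0 : ℝ)) hq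
  have h3 : ∫⁻ t in Ioi (0 : ℝ), ω {y | t < max (u y) 0} ^ (1 / q) ≤
      C * ∫⁻ y, ∫⁻ z, ENNReal.ofReal |u z - u y| * k z y ∂ν ∂ν := by
    calc ∫⁻ t in Ioi (0 : ℝ), ω {y | t < max (u y) 0} ^ (1 / q)
        ≤ ∫⁻ t in Ioi (0 : ℝ), C * kernelPerimeter ν k {x | t < u x} := by
          refine setLIntegral_mono' measurableSet_Ioi fun t ht => ?_
          have : {y | t < max (u y) 0} = {y | t < u y} := by
            ext y
            simp [not_lt.2 (le_of_lt (mem_Ioi.1 ht))]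
          rw [this]
          refine (ENNReal.rpow_le_rpow (h t ht) (by positivity)).trans (le_of_eq ?_)
          rw [← ENNReal.rpow_mul, mul_one_div_cancel hq0.ne', ENNReal.rpow_one]
      _ = C * ∫⁻ t in Ioi (0 : ℝ), _ := lintegral_const_mul' _ _ hC
      _ ≤ _ := by
          gcongr
          exact lintegral_kernelPerimeter_le hk hu
  calc _ ≤ (ENNReal.ofReal q * (C * ∫⁻ y, ∫⁻ z,
          ENNReal.ofReal |u z - u y| * k z y ∂ν ∂ν) ^ q) ^ (1 / q) := by
        refine ENNReal.rpow_le_rpow (h2.trans ?_) (by positivity)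
        gcongr
    _ = _ := by
        rw [ENNReal.mul_rpow_of_nonneg _ _ (by positivity), ← ENNReal.rpow_mul,
          mul_one_div_cancel hq0.ne', ENNReal.rpow_one]

/-- An isoperimetric inequality implies a Sobolev--Poincaré inequality. -/
theorem exists_eLpNorm_sub_const_le_of_isoperimetric {ν ω : Measure Y} [SFinite ν]
    {k : Y → Y → ENNReal} (hk : Measurable (Function.uncurry k)) {q : ℝ} (hq : 1 ≤ q)
    {C : ENNReal} (hC : C ≠ ⊤) {B : Set Y} (hB : MeasurableSet B) (hB0 : ν B ≠ 0)
    (hBt : ν B ≠ ⊤)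
    (h : ∀ E : Set Y, MeasurableSet E → ¬ ν B < 2 * ν (E ∩ B) → ω E ≤ (C * kernelPerimeter ν k E) ^ q)
    {u : Y → ℝ} (hu : Measurable u) :
    ∃ a : ℝ, eLpNorm (fun y => u y - a) (ENNReal.ofReal q) ω ≤
      2 * (ENNReal.ofReal q ^ (1 / q) * C) *
        ∫⁻ y, ∫⁻ z, ENNReal.ofReal |u z - u y| * k z y ∂ν ∂ν := by
  have : IsFiniteMeasure (ν.restrict B) := ⟨by simpa using hBt.lt_top⟩
  -- A median on `B` makes every positive superlevel set of `u - a` and of `a - u` fill at most half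
  -- of `B`. Adding the two one-sided bounds produces the factor `2`.
  obtain ⟨a, ha1, ha2⟩ := exists_median (m := ν.restrict B) (by simpa using hB0) hu
  simp only [Measure.restrict_apply' hB, univ_inter] at ha1 ha2
  refine ⟨a, ?_⟩
  have hpos := eLpNorm_max_zero_le_of_isoperimetric (ν := ν) (ω := ω) hk hq hC
    (u := fun y => u y - a) (hu.sub_const a) fun t ht => by
      refine h _ (measurableSet_lt measurable_const (hu.sub_const a)) (not_lt.2 (le_trans ?_ ha1))
      gcongr 2 * ν (?_ ∩ B)
      intro y hy
      simp only [mem_ofPred_eq] at hy ⊢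
      linarith
  have hneg := eLpNorm_max_zero_le_of_isoperimetric (ν := ν) (ω := ω) hk hq hC
    (u := fun y => a - u y) (hu.const_sub a) fun t ht => by
      refine h _ (measurableSet_lt measurable_const (hu.const_sub a)) (not_lt.2 (le_trans ?_ ha2))
      gcongr 2 * ν (?_ ∩ B)
      intro y hy
      simp only [mem_ofPred_eq] at hy ⊢
      linarith
  have e1 : ∀ z y, |u z - a - (u y - a)| = |u z - u y| := fun z y => by congr 1; ring
  have e2 : ∀ z y, |a - u z - (a - u y)| = |u z - u y| := fun z y => by
    rw [abs_sub_comm]; congr 1; ring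
  simp only [e1] at hpos
  simp only [e2] at hneg
  have hdecomp : (fun y => u y - a) =
      (fun y => max (u y - a) 0) - fun y => max (a - u y) 0 := by
    ext y
    simp only [Pi.sub_apply]
    rcases le_total (u y) a with h | h
    · rw [max_eq_right (by linarith), max_eq_left (by linarith)]
      ring
    · rw [max_eq_left (by linarith), max_eq_right (by linarith)]
      ring
  rw [hdecomp]
  refine (eLpNorm_sub_le ((hu.sub_const a).max measurable_const).aestronglyMeasurable
    ((hu.const_sub a).max measurable_const).aestronglyMeasurable
    (by simpa using hq)).trans ((add_le_add hpos hneg).trans (le_of_eq ?_))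
  ring

end Coarea

/-! ### Transfer between the subtype `Ω` and `X`. -/

theorem measurable_truncKernel {Y : Type*} [MetricSpace Y] [SecondCountableTopology Y]
    [MeasurableSpace Y] [BorelSpace Y] {d ρ : Y → ℝ} {Φ : ℝ → ℝ} {γ τ cu m : ℝ}
    (hd : Measurable d) (hΦ : Measurable fun y => Φ (ρ y)) :
    Measurable (Function.uncurry (truncKernel d ρ Φ γ τ cu m)) := by
  have hS : MeasurableSet {p : Y × Y | dist p.1 p.2 ≤ τ * d p.2} :=
    measurableSet_le (measurable_fst.dist measurable_snd) ((hd.comp measurable_snd).const_mul τ)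
  have hw : Measurable fun y => d y ^ γ * Φ (ρ y) := (hd.pow_const γ).mul hΦ
  exact ((((hw.comp measurable_fst).min (hw.comp measurable_snd)).ennreal_ofReal).div
    (((measurable_fst.dist measurable_snd).pow_const m).const_mul cu).ennreal_ofReal).indicator hS

theorem withDensity_restrict_eq_map {X : Type*} [MeasurableSpace X] {μ : Measure X} {Ω : Set X} (hΩ : MeasurableSet Ω) (W : X → ENNReal) :
    (μ.restrict Ω).withDensity W =
      ((μ.comap ((↑) : Ω → X)).withDensity fun y => W y).map (↑) := by
  have hemb := MeasurableEmbedding.subtype_coe hΩ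
  ext t ht
  rw [withDensity_apply _ ht, hemb.map_apply, withDensity_apply _ (measurable_subtype_coe ht),
    ← map_comap_subtype_coe hΩ, hemb.restrict_map, hemb.lintegral_map]

theorem measurable_comp_of_monotoneOn {Y : Type*} [MeasurableSpace Y] {ρ : Y → ℝ} {φ : ℝ → ℝ}
    (hρ : Measurable ρ) (hρpos : ∀ y, 0 < ρ y) (hφpos : ∀ t : ℝ, 0 < t → 0 < φ t)
    (hφmono : MonotoneOn φ (Ioi 0)) : Measurable fun y => φ (ρ y) := by
  -- `φ` is controlled only on `(0, ∞)`; its extension by zero is monotone on `ℝ`, hence Borel.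
  have hmono : Monotone ((Ioi (0 : ℝ)).indicator φ) := by
    intro a b hab
    by_cases ha : a ∈ Ioi (0 : ℝ)
    · have hb : b ∈ Ioi (0 : ℝ) := lt_of_lt_of_le ha hab
      rw [indicator_of_mem ha, indicator_of_mem hb]
      exact hφmono ha hb hab
    · rw [indicator_of_notMem ha]
      exact indicator_nonneg (fun t ht => (hφpos t ht).le) b
  have h := hmono.measurable.comp hρ
  have heq : (Ioi (0 : ℝ)).indicator φ ∘ ρ = fun y => φ (ρ y) :=
    funext fun y => indicator_of_mem (mem_Ioi.2 (hρpos y)) φ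
  rwa [heq] at h

theorem lintegral_truncKernel_le_fracSeminorm {X : Type*} [MetricSpace X] [MeasurableSpace X]
    [BorelSpace X] {μ : Measure X} {Ω F : Set X} (hΩ : MeasurableSet Ω)
    {Φ : ℝ → ℝ} {n s γ τ cu : ℝ} (hcu : 0 < cu)
    (hup : ∀ z ∈ Ω, ∀ y ∈ Ω, z ≠ y → dist z y ≤ τ * bdryDist Ω y →
      μ (ball z (dist z y)) ≤ ENNReal.ofReal (cu * dist z y ^ n)) (u : X → ℝ) :
    ∫⁻ y : Ω, ∫⁻ z : Ω, ENNReal.ofReal |u z - u y| *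
        truncKernel (fun y : Ω => bdryDist Ω y) (fun y => infDist (y : X) F) Φ γ τ cu (n + s) z y
          ∂μ.comap (↑) ∂μ.comap (↑) ≤
      fracSeminorm μ Ω s 1 τ (pairWeight Ω F Φ γ) u := by
  rw [fracSeminorm, div_one, ENNReal.rpow_one, ← lintegral_subtype_comap hΩ]
  refine lintegral_mono fun y => ?_
  have hT : MeasurableSet {z | dist z (y : X) ≤ τ * bdryDist Ω y} :=
    (isClosed_closedBall (x := (y : X)) (ε := τ * bdryDist Ω y)).measurableSet
  rw [inter_comm, ← Measure.restrict_restrict hT, ← lintegral_indicator hT,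
    ← lintegral_subtype_comap hΩ]
  refine lintegral_mono fun z => ?_
  by_cases hz : dist (z : X) y ≤ τ * bdryDist Ω y
  · rw [truncKernel, indicator_of_mem (by exact hz), indicator_of_mem (by exact hz)]
    -- On the diagonal the kernel may be infinite, but the factor `|u z - u y|` vanishes.
    by_cases hzy : z = y
    · simp [hzy]
    have hzy' : (z : X) ≠ y := fun h => hzy (Subtype.ext h)
    have hpos : 0 < dist (z : X) y := dist_pos.2 hzy'
    rw [Real.rpow_one, mul_one, ENNReal.ofReal_mul (abs_nonneg _), mul_div_assoc]
    gcongr ENNReal.ofReal _ * (ENNReal.ofReal ?_ / ?_)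
    · exact le_rfl
    · rw [Subtype.dist_eq, Real.rpow_add hpos, ← mul_assoc, ENNReal.ofReal_mul (by positivity)]
      gcongr
      exact hup z z.2 y y.2 hzy' hz
  · rw [truncKernel, indicator_of_notMem (by exact hz)]
    simp

/-- For the lower bound, `κ` keeps the ball inside `Ω` and `1 / 2` keeps the radius below the
diameter. The upper bound must hold at all radii: small closed balls sit in open balls of twice the
radius, and large ones are absorbed by `μ Ω < ⊤`. -/
theorem closedBall_comap_bounds {X : Type*} [MetricSpace X] [MeasurableSpace X] {μ : Measure X}
    {n cl cu κ : ℝ} (hcu : 0 < cu) (hn : 0 < n)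
    (hμ : ∀ (x : X) (r : ℝ), 0 < r → ENNReal.ofReal r < Metric.ediam (univ : Set X) →
      ENNReal.ofReal (cl * r ^ n) ≤ μ (ball x r) ∧ μ (ball x r) ≤ ENNReal.ofReal (cu * r ^ n))
    {Ω : Set X} (hΩ : MeasurableSet Ω) (hΩfin : μ Ω < ⊤) (hD : Metric.ediam (univ : Set X) ≠ 0)
    (hball : ∀ x ∈ Ω, ball x (κ * bdryDist Ω x) ⊆ Ω)
    (hdD : ∀ x ∈ Ω, 0 < bdryDist Ω x ∧
      ENNReal.ofReal (bdryDist Ω x) ≤ Metric.ediam (univ : Set X)) :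
    (∀ (x : Ω) (r : ℝ), 0 < r → r ≤ min κ (1 / 2) * bdryDist Ω x →
      ENNReal.ofReal (cl * r ^ n) ≤ μ.comap ((↑) : Ω → X) (closedBall x r)) ∧
    ∃ cu' : ℝ, cu ≤ cu' ∧ ∀ (x : Ω) (r : ℝ), 0 < r →
      μ.comap ((↑) : Ω → X) (closedBall x r) ≤ ENNReal.ofReal (cu' * r ^ n) := by
  constructor
  · intro x r hr hrκ
    obtain ⟨hdx, hdxD⟩ := hdD x x.2
    have h1 : r ≤ κ * bdryDist Ω x :=
      hrκ.trans (mul_le_mul_of_nonneg_right (min_le_left _ _) hdx.le)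
    have h2 : r ≤ 1 / 2 * bdryDist Ω x :=
      hrκ.trans (mul_le_mul_of_nonneg_right (min_le_right _ _) hdx.le)
    have hrD : ENNReal.ofReal r < Metric.ediam (univ : Set X) :=
      lt_of_lt_of_le ((ENNReal.ofReal_lt_ofReal_iff hdx).2 (by linarith)) hdxD
    refine (hμ x r hr hrD).1.trans ?_
    rw [comap_subtype_coe_apply hΩ]
    refine measure_mono fun y hy => ?_
    exact ⟨⟨y, hball x x.2 (ball_subset_ball h1 hy)⟩, (mem_ball.1 hy).le, rfl⟩
  · obtain ⟨R, hR0, hRD⟩ : ∃ R : ℝ, 0 < R ∧ ENNReal.ofReal R < Metric.ediam (univ : Set X) := by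
      obtain ⟨R, h1, h2⟩ := ENNReal.lt_iff_exists_nnreal_btwn.1 (pos_iff_ne_zero.2 hD)
      exact ⟨R, by simpa using h1, by simpa using h2⟩
    set V := (μ Ω).toReal with hV
    have hV0 : 0 ≤ V := ENNReal.toReal_nonneg
    refine ⟨cu * 2 ^ n + V / (R / 2) ^ n, ?_, fun x r hr => ?_⟩
    · have h1 : 1 ≤ (2 : ℝ) ^ n := Real.one_le_rpow (by norm_num) hn.le
      have h2 : 0 ≤ V / (R / 2) ^ n := by positivity
      nlinarith
    rw [comap_subtype_coe_apply hΩ]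
    rcases le_total (2 * r) R with h | h
    · have hrD := (ENNReal.ofReal_le_ofReal h).trans_lt hRD
      refine (measure_mono ?_).trans ((hμ x (2 * r) (by positivity) hrD).2.trans
        (ENNReal.ofReal_le_ofReal ?_))
      · rintro - ⟨y, hy, rfl⟩
        have : dist (y : X) x ≤ r := hy
        rw [mem_ball]
        linarith
      · rw [Real.mul_rpow (by norm_num) hr.le, ← mul_assoc]
        have h2 : 0 ≤ V / (R / 2) ^ n := by positivity
        gcongr
        linarith
    · calc μ ((↑) '' closedBall x r) ≤ μ Ω := measure_mono (by rintro - ⟨y, -, rfl⟩; exact y.2)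
        _ = ENNReal.ofReal V := (ENNReal.ofReal_toReal hΩfin.ne).symm
        _ ≤ _ := by
          refine ENNReal.ofReal_le_ofReal ?_
          have h3 : (R / 2) ^ n ≤ r ^ n := Real.rpow_le_rpow (by positivity) (by linarith) hn.le
          have h4 : V ≤ V / (R / 2) ^ n * r ^ n := by
            calc V = V / (R / 2) ^ n * (R / 2) ^ n := by field_simp
              _ ≤ _ := by gcongr
          have h5 : 0 ≤ cu * 2 ^ n * r ^ n := by positivity
          linarith

theorem IsJohnDomain.exists_isPreconnected {X : Type*} [MetricSpace X] {Ω : Set X} (hΩ : IsJohnDomain Ω) :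
    ∃ (x₀ : Ω) (cJ : ℝ), 0 < cJ ∧ ∀ x : Ω, ∃ S : Set Ω, IsPreconnected S ∧ x ∈ S ∧ x₀ ∈ S ∧
      ∀ p ∈ S, dist x p ≤ cJ * bdryDist Ω p := by
  obtain ⟨x₀, hx₀, cJ, hcJ, hJ⟩ := hΩ.exists_curve
  refine ⟨⟨x₀, hx₀⟩, cJ, hcJ, fun x => ?_⟩
  obtain ⟨l, c, hl, hc, hmaps, h0, h1, hd⟩ := hJ x x.2
  have hlip := lipschitzOnWith_of_hasUnitSpeedOn hc
  have : PreconnectedSpace (Icc 0 l) := Subtype.preconnectedSpace isPreconnected_Icc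
  refine ⟨range (hmaps.restrict c _ _), isPreconnected_range ?_, ⟨⟨0, le_rfl, hl⟩, ?_⟩,
    ⟨⟨l, hl, le_rfl⟩, ?_⟩, ?_⟩
  · exact hlip.continuousOn.mapsToRestrict hmaps
  · exact Subtype.ext h0
  · exact Subtype.ext h1
  · rintro - ⟨⟨t, ht⟩, rfl⟩
    have h2 := hlip.dist_le_mul 0 ⟨le_rfl, hl⟩ t ht
    simp only [NNReal.coe_one, one_mul, dist_zero_left, Real.norm_eq_abs, abs_of_nonneg ht.1,
      h0] at h2
    have h3 := hd t ht
    rw [div_le_iff₀ hcJ] at h3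
    change dist (x : X) (c t) ≤ cJ * bdryDist Ω (c t)
    linarith

end FracPoincare

end

/-! ### The weighted fractional Sobolev–Poincaré inequality. -/

open FracPoincare Metric in
theorem mainTheorem3 {X : Type*} [MetricSpace X] [MeasurableSpace X] [BorelSpace X]
    (μ : Measure X) (n : ℝ) (hn : 0 < n) (hμ : FracPoincare.IsAhlforsDavidRegular μ n)
    (s τ γ : ℝ) (hs : s ∈ Ioo (0 : ℝ) 1) (hτ : τ ∈ Ioo (0 : ℝ) 1)
    (hγ : 0 ≤ γ) (hγs : γ < s) (hsn : s ≤ n) (hsγn : s - γ < n)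
    (Ω : Set X) (hΩ : FracPoincare.IsJohnDomain Ω) (hΩb : Bornology.IsBounded Ω)
    (hΩball : ∃ κ : ℝ, 0 < κ ∧ ∀ x ∈ Ω, Metric.ball x (κ * FracPoincare.bdryDist Ω x) ⊆ Ω)
    (F : Set X) (hF : IsCompact F) (hFne : F.Nonempty) (hFΩ : F ⊆ frontier Ω)
    (φ : ℝ → ℝ) (hφpos : ∀ t : ℝ, 0 < t → 0 < φ t) (hφmono : MonotoneOn φ (Ioi 0))
    (hφdbl : ∃ K : ℝ, ∀ t : ℝ, 0 < t → φ (2 * t) ≤ K * φ t)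
    (hφloc : LocallyIntegrableOn (FracPoincare.distWeight F φ) Ω μ) :
    ∃ C : ℝ, 0 < C ∧ ∀ u : X → ℝ, IntegrableOn u Ω μ →
      (⨅ a : ℝ, FracPoincare.weightedNorm μ Ω (FracPoincare.sobolevExponent n (s - γ) 1)
          (FracPoincare.distWeight F φ) (fun x => u x - a)) ≤
        ENNReal.ofReal C *
          FracPoincare.fracSeminorm μ Ω s 1 τ
            (FracPoincare.pairWeight Ω F
              (fun t => φ t ^ (1 / FracPoincare.sobolevExponent n (s - γ) 1)) γ) u := by
  have hexp : sobolevExponent n (s - γ) 1 = n / (n - (s - γ)) := by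
    rw [sobolevExponent, mul_one, mul_one]
  rw [hexp]
  set q := n / (n - (s - γ)) with hq
  have hq1 : 1 ≤ q := by rw [hq, le_div_iff₀ (by linarith)]; linarith
  have hq0 : 0 < q := by linarith
  have hΩm := hΩ.isOpen.measurableSet
  obtain ⟨f₀, hf₀⟩ := hFne.mono hFΩ
  have hdisj : ∀ x ∈ Ω, x ∉ frontier Ω := fun x hx hx' => by
    rw [hΩ.isOpen.frontier_eq] at hx'
    exact hx'.2 hx
  have hdpos : ∀ x ∈ Ω, 0 < bdryDist Ω x := fun x hx =>
    (isClosed_frontier.notMem_iff_infDist_pos ⟨f₀, hf₀⟩).1 (hdisj x hx)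
  have hdD : ∀ x ∈ Ω, 0 < bdryDist Ω x ∧
      ENNReal.ofReal (bdryDist Ω x) ≤ Metric.ediam (univ : Set X) := fun x hx => by
    refine ⟨hdpos x hx, (ENNReal.ofReal_le_ofReal (infDist_le_dist_of_mem hf₀)).trans ?_⟩
    rw [← edist_dist]
    exact Metric.edist_le_ediam_of_mem (mem_univ _) (mem_univ _)
  obtain ⟨x₀, cJ, hcJ, hchain⟩ := hΩ.exists_isPreconnected
  have hD : Metric.ediam (univ : Set X) ≠ 0 := fun h => by
    obtain ⟨h1, h2⟩ := hdD x₀ x₀.2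
    rw [h, nonpos_iff_eq_zero, ENNReal.ofReal_eq_zero] at h2
    linarith
  obtain ⟨htb, hfin⟩ := hΩ.totallyBounded_and_measure_lt_top hμ hD
  have hsep : TopologicalSpace.SeparableSpace Ω := htb.isSeparable.separableSpace
  have hsc : SecondCountableTopology Ω := UniformSpace.secondCountable_of_separable Ω
  obtain ⟨cl, cu, hcl, hcu, hμ⟩ := hμ
  obtain ⟨κ, hκ, hball⟩ := hΩball
  obtain ⟨hlow, cu', hcu', hup⟩ :=
    closedBall_comap_bounds hcu hn hμ hΩm hfin hD hball hdD
  have hcu'0 : 0 < cu' := hcu.trans_le hcu'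
  set ν := μ.comap ((↑) : Ω → X) with hν
  have : IsFiniteMeasure ν := ⟨by
    rw [hν, comap_subtype_coe_apply hΩm, image_univ, Subtype.range_coe]
    exact hfin⟩
  have hdlip : LipschitzWith 1 fun y : Ω => bdryDist Ω y := by
    have h := (lipschitz_infDist_pt (frontier Ω)).comp (LipschitzWith.subtype_val Ω)
    rwa [one_mul] at h
  have hρlip : LipschitzWith 1 fun y : Ω => infDist (y : X) F := by
    have h := (lipschitz_infDist_pt F).comp (LipschitzWith.subtype_val Ω)
    rwa [one_mul] at h
  have hdρ : ∀ y : Ω, bdryDist Ω y ≤ infDist (y : X) F := fun y =>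
    infDist_le_infDist_of_subset hFΩ hFne
  have hρpos : ∀ y : Ω, 0 < infDist (y : X) F := fun y => (hdpos y y.2).trans_le (hdρ y)
  -- `τ / 8` keeps pairs in a balanced ball within the truncation; `min κ (1 / 2)` is the range of
  -- the lower volume bound.
  set ε := min (τ / 8) (min κ (1 / 2)) with hε
  have hε0 : 0 < ε := lt_min (by linarith [hτ.1]) (lt_min hκ (by norm_num))
  obtain ⟨C, hC, hiso⟩ := exists_measure_le_kernelPerimeter (ν := ν) hdlip
    (fun y => hdpos y y.2) hρlip hdρ hφpos hφmono hφdbl hn hs.1 hτ.2 hγ hγs hsγn hcl hcu'0 hlow hup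
    hε0 (min_le_left _ _) (min_le_right _ _) hcJ hchain
  have hdx₀ : 0 < ε * bdryDist Ω x₀ := mul_pos hε0 (hdpos x₀ x₀.2)
  have hB0 : ν (closedBall x₀ (ε * bdryDist Ω x₀)) ≠ 0 := by
    refine (lt_of_lt_of_le ?_ (hlow x₀ _ hdx₀ (mul_le_mul_of_nonneg_right (min_le_right _ _)
      (hdpos x₀ x₀.2).le))).ne'
    rw [ENNReal.ofReal_pos]
    positivity
  have hΦm : Measurable fun y : Ω => φ (infDist (y : X) F) ^ (1 / q) :=
    (measurable_comp_of_monotoneOn hρlip.continuous.measurable hρpos hφpos hφmono).pow_const _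
  refine ⟨2 * (q ^ (1 / q) * C), by positivity, fun u hu => ?_⟩
  -- The coarea argument needs a measurable function, so `u` is replaced by a representative; both
  -- sides are unchanged.
  have huν : AEMeasurable (fun y : Ω => u y) ν := by
    have h1 := hu.aestronglyMeasurable.aemeasurable
    rw [← map_comap_subtype_coe hΩm] at h1
    exact h1.comp_measurable measurable_subtype_coe
  obtain ⟨a, ha⟩ := exists_eLpNorm_sub_const_le_of_isoperimetric
    (measurable_truncKernel hdlip.continuous.measurable hΦm) hq1 ENNReal.ofReal_ne_top
    isClosed_closedBall.measurableSet hB0 (measure_ne_top ν _) hiso huν.measurable_mk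
  refine (iInf_le _ a).trans ?_
  have hL : weightedNorm μ Ω q (distWeight F φ) (fun x => u x - a) =
      eLpNorm (fun y => huν.mk _ y - a) (ENNReal.ofReal q)
        (ν.withDensity fun y => ENNReal.ofReal (φ (infDist (y : X) F))) := by
    rw [weightedNorm, withDensity_restrict_eq_map hΩm,
      (MeasurableEmbedding.subtype_coe hΩm).eLpNorm_map_measure]
    refine eLpNorm_congr_ae ((withDensity_absolutelyContinuous _ _).ae_le ?_)
    filter_upwards [huν.ae_eq_mk] with y hy
    simp only [Function.comp, hy]
  rw [hL]
  refine ha.trans ?_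
  rw [ENNReal.ofReal_mul (by norm_num), ENNReal.ofReal_mul (by positivity), ENNReal.ofReal_ofNat,
    ← ENNReal.ofReal_rpow_of_pos hq0]
  gcongr
  refine le_trans (le_of_eq ?_) (lintegral_truncKernel_le_fracSeminorm hΩm hcu'0 ?_ u (n := n))
  · refine lintegral_congr_ae ?_
    filter_upwards [huν.ae_eq_mk] with y hy
    refine lintegral_congr_ae ?_
    filter_upwards [huν.ae_eq_mk] with z hz
    rw [← hy, ← hz]
  · intro z hz y hy hzy hdist
    have hpos : 0 < dist z y := dist_pos.2 hzy
    have hlt : dist z y < bdryDist Ω y :=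
      hdist.trans_lt (mul_lt_of_lt_one_left (hdpos y hy) hτ.2)
    refine (hμ z (dist z y) hpos (lt_of_lt_of_le
      ((ENNReal.ofReal_lt_ofReal_iff (hdpos y hy)).2 hlt) (hdD y hy).2)).2.trans
      (ENNReal.ofReal_le_ofReal ?_)
    gcongr
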